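/- Let $n\ge 1$ and $0\le p\le n-1$ be integers, let $\mathbb T^m=\mathbb R^m/2\pi\mathbb Z^m$, and let $a_0=\sum_{j=1}^n a_{j0}\,dt_j$ be a constant (hence closed) real $1$-form on $\mathbb T^n$. On $\mathbb T^n_t\times\mathbb T^1_x$ consider the forms $u=\sum_{|K|=p}u_K\,dt_K$, $dt_K=dt_{k_1}\wedge\dots\wedge dt_{k_p}$, $k_1<\dots<k_p$, whose coefficients $u_K(t,x)$ are smooth functions ($p$-forms) or distributions ($p$-currents), and for every $p$ the operator $$\mathbb L^p u=\Big(d_t+a_0\wedge\frac{\partial}{\partial x}\Big)u=\sum_{j=1}^n\sum_{|K|=p}\Big(\frac{\partial u_K}{\partial t_j}+a_{j0}\frac{\partial u_K}{\partial x}\Big)\,dt_j\wedge dt_K .$$ A constant real $1$-form $c$ on $\mathbb T^n$ is called *integral* if $\frac1{2\pi}\int_\sigma c\in\mathbb Z$ for every $1$-cycle $\sigma$ in $\mathbb T^n$, and *rational* if $qc$ is integral for some positive integer $q$. The form $a_0$ is called *Liouville* if it is not rational and there are a constant $C>0$ and a sequence $(\eta_l,\xi_l)_{l\in\mathbb N}$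 in $\mathbb Z^n\times\mathbb Z$ with $|\xi_l|\ge 2$ and $$\max_{1\le j\le n}|\eta_{j,l}+a_{j0}\,\xi_l|\le C\,|(\eta_l,\xi_l)|^{-l}\qquad(l\in\mathbb N).$$ For a smooth $f=\sum_{|J|=p+1}f_J\,dt_J$ put $\widehat f(t,\xi)=\sum_{|J|=p+1}\widehat{f_J}(t,\xi)\,dt_J$, where $\widehat{f_J}(t,\xi)=\frac1{2\pi}\int_0^{2\pi}f_J(t,x)e^{-i\xi x}\,dx$. Let $\mathbb E^p$ be the set of smooth $(p+1)$-forms $f$ as above such that $\mathbb L^{p+1}f=0$ and such that, for each $\xi\in\mathbb Z$ for which $\xi a_0$ is integral, the form $e^{i\psi_\xi(t)}\widehat f(t,\xi)$ is exact on $\mathbb T^n$, where $\psi_\xi:\mathbb R^n\to\mathbb R$ is a primitive of the pull-back of $\xi a_0$ to $\mathbb R^n$. The operator $\mathbb L^p$ is called *globally solvable* if for every $f\in\mathbb E^p$ there is a $p$-current $u$ (as above, with coefficients in $\mathcal D'(\mathbb T^n\times\mathbb T^1)$) with $\mathbb L^pu=f$. **Theorem.** For each $p=0,1,\dots,n-1$,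 the operator $\mathbb L^p$ is globally solvable if and only if $a_0$ is either rational or non-Liouville. -/

import Mathlib

open scoped ContDiff

noncomputable section

namespace TorusComplex

/-- `C^∞(𝕋^ι)`, where `𝕋^ι = ℝ^ι / 2πℤ^ι`: the smooth complex functions on `ℝ^ι` that are
`2π`-periodic in every variable. -/
def Smooth (ι : Type) [Fintype ι] : Submodule ℂ ((ι → ℝ) → ℂ) where
  carrier := {f | ContDiff ℝ ∞ f ∧
    ∀ (x : ι → ℝ) (k : ι → ℤ), f (fun i => x i + 2 * Real.pi * (k i : ℝ)) = f x}
  add_mem' := by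
    rintro f g ⟨hf, hf'⟩ ⟨hg, hg'⟩
    exact ⟨hf.add hg, fun x k => by simp only [Pi.add_apply, hf', hg']⟩
  zero_mem' := ⟨contDiff_const, fun _ _ => rfl⟩
  smul_mem' := by
    rintro c f ⟨hf, hf'⟩
    exact ⟨hf.const_smul c, fun x k => by simp only [Pi.smul_apply, hf']⟩

theorem Smooth.contDiff {ι : Type} [Fintype ι] (f : Smooth ι) : ContDiff ℝ ∞ (f : (ι → ℝ) → ℂ) := f.2.1

theorem Smooth.differentiable {ι : Type} [Fintype ι] (f : Smooth ι) : Differentiable ℝ (f : (ι → ℝ) → ℂ) :=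
  (Smooth.contDiff f).differentiable (by simp)

/-- The partial derivative `∂/∂x_i` on `C^∞(𝕋^ι)`. -/
def Smooth.pderiv {ι : Type} [Fintype ι] [DecidableEq ι] (i : ι) : Smooth ι →ₗ[ℂ] Smooth ι where
  toFun f := ⟨fun x => fderiv ℝ (f : (ι → ℝ) → ℂ) x (Pi.single i 1), by
    refine ⟨((Smooth.contDiff f).fderiv_right (m := ∞) (by simp)).clm_apply contDiff_const, fun x k => ?_⟩
    have h : (fun y : ι → ℝ => (f : (ι → ℝ) → ℂ) (y + fun i => 2 * Real.pi * (k i : ℝ))) = f :=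
      funext fun y => f.2.2 y k
    have h2 := fderiv_comp_add_right (𝕜 := ℝ) (f := (f : (ι → ℝ) → ℂ)) (x := x)
      (fun i => 2 * Real.pi * (k i : ℝ))
    rw [h] at h2
    exact congrArg (fun L => L (Pi.single i 1)) h2.symm⟩
  map_add' f g := by
    ext x
    simp only [Submodule.coe_add, Pi.add_apply]
    rw [fderiv_add (Smooth.differentiable f).differentiableAt (Smooth.differentiable g).differentiableAt]
    rfl
  map_smul' c f := by
    ext x
    simp only [Submodule.coe_smul, Pi.smul_apply, RingHom.id_apply]
    rw [fderiv_const_smul (Smooth.differentiable f).differentiableAt]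
    rfl

/-- `𝒟'(𝕋^ι)`: the linear functionals on `C^∞(𝕋^ι)` that are continuous for the topology of
uniform convergence of all derivatives, that is, bounded by the `C^k`-norm for some `k`. -/
def Distribution (ι : Type) [Fintype ι] : Submodule ℂ (Smooth ι →ₗ[ℂ] ℂ) where
  carrier := {u | ∃ (k : ℕ) (C : ℝ), ∀ (φ : Smooth ι) (M : ℝ),
    (∀ j ≤ k, ∀ x, ‖iteratedFDeriv ℝ j (φ : (ι → ℝ) → ℂ) x‖ ≤ M) → ‖u φ‖ ≤ C * M}
  add_mem' := by
    rintro u v ⟨k, C, hu⟩ ⟨l, D, hv⟩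
    refine ⟨max k l, C + D, fun φ M h => ?_⟩
    have h1 := hu φ M fun j hj => h j (hj.trans (le_max_left _ _))
    have h2 := hv φ M fun j hj => h j (hj.trans (le_max_right _ _))
    calc ‖(u + v) φ‖ ≤ ‖u φ‖ + ‖v φ‖ := norm_add_le _ _
      _ ≤ (C + D) * M := by linarith
  zero_mem' := ⟨0, 0, fun φ M _ => by simp⟩
  smul_mem' := by
    rintro c u ⟨k, C, hu⟩
    refine ⟨k, ‖c‖ * C, fun φ M h => ?_⟩
    rw [LinearMap.smul_apply, norm_smul, mul_assoc]
    exact mul_le_mul_of_nonneg_left (hu φ M h) (norm_nonneg c)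

theorem Smooth.norm_iteratedFDeriv_pderiv_le {ι : Type} [Fintype ι] [DecidableEq ι]
    (i : ι) (φ : Smooth ι) (j : ℕ) (x : ι → ℝ) :
    ‖iteratedFDeriv ℝ j (Smooth.pderiv i φ : (ι → ℝ) → ℂ) x‖ ≤
      ‖iteratedFDeriv ℝ (j + 1) (φ : (ι → ℝ) → ℂ) x‖ := by
  have hd : ContDiff ℝ j (fderiv ℝ (φ : (ι → ℝ) → ℂ)) :=
    (Smooth.contDiff φ).fderiv_right (by exact_mod_cast le_top)
  have h := (ContinuousLinearMap.apply ℝ ℂ (Pi.single i 1 : ι → ℝ)).norm_iteratedFDeriv_comp_left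
    (hd.contDiffAt (x := x)) (le_refl (j : WithTop ℕ∞))
  have hn : ‖ContinuousLinearMap.apply ℝ ℂ (Pi.single i 1 : ι → ℝ)‖ ≤ 1 := by
    refine ContinuousLinearMap.opNorm_le_bound _ zero_le_one fun L => ?_
    have hs : ‖(Pi.single i 1 : ι → ℝ)‖ ≤ 1 := by
      rw [Pi.norm_single]; simp
    calc ‖L (Pi.single i 1)‖ ≤ ‖L‖ * ‖(Pi.single i 1 : ι → ℝ)‖ := L.le_opNorm _
      _ ≤ ‖L‖ * 1 := mul_le_mul_of_nonneg_left hs (norm_nonneg L)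
      _ = 1 * ‖L‖ := by ring
  rw [norm_iteratedFDeriv_fderiv] at h
  refine (h.trans (mul_le_mul_of_nonneg_right hn (norm_nonneg _))).trans (le_of_eq (one_mul _))

/-- The partial derivative of distributions: `⟨∂_i u, φ⟩ = -⟨u, ∂_i φ⟩`. -/
def Distribution.pderiv {ι : Type} [Fintype ι] [DecidableEq ι] (i : ι) :
    Distribution ι →ₗ[ℂ] Distribution ι where
  toFun u := ⟨-((u : Smooth ι →ₗ[ℂ] ℂ) ∘ₗ Smooth.pderiv i), by
    obtain ⟨k, C, hu⟩ := u.2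
    refine ⟨k + 1, C, fun φ M h => ?_⟩
    rw [LinearMap.neg_apply, norm_neg]
    exact hu _ M fun j hj x =>
      (Smooth.norm_iteratedFDeriv_pderiv_le i φ j x).trans (h (j + 1) (by omega) x)⟩
  map_add' u v := by
    refine Subtype.ext (LinearMap.ext fun φ => ?_)
    exact neg_add ((u : Smooth ι →ₗ[ℂ] ℂ) (Smooth.pderiv i φ)) _
  map_smul' c u := by
    refine Subtype.ext (LinearMap.ext fun φ => ?_)
    exact (smul_neg c ((u : Smooth ι →ₗ[ℂ] ℂ) (Smooth.pderiv i φ))).symm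

/-- The distribution `u` is the smooth function `f`: `⟨u, φ⟩ = ∫_{𝕋^ι} f φ` for all `φ`. -/
def Distribution.IsFunction {ι : Type} [Fintype ι] (u : Distribution ι) (f : Smooth ι) : Prop :=
  ∀ φ : Smooth ι, (u : Smooth ι →ₗ[ℂ] ℂ) φ =
    ∫ x in Set.Icc (0 : ι → ℝ) (fun _ => 2 * Real.pi),
      (f : (ι → ℝ) → ℂ) x * (φ : (ι → ℝ) → ℂ) x

/-- The multi-indices `K = (k_1 < ⋯ < k_p)` with entries in `{1, …, n}`. -/
abbrev MultiIndex (n p : ℕ) : Type := {K : Finset (Fin n) // K.card = p}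

/-- The coefficient of `dt_J` in `dt_j ∧ dt_K`. -/
def wedgeCoeff {n p : ℕ} (j : Fin n) (K : MultiIndex n p) (J : MultiIndex n (p + 1)) : ℂ :=
  if j ∉ K.1 ∧ J.1 = insert j K.1 then (-1) ^ (K.1.filter (· < j)).card else 0

/-- For operators `X_1, …, X_n` on the space `M` of coefficients, the map
`∑_K u_K dt_K ↦ ∑_j ∑_K (X_j u_K) dt_j ∧ dt_K` from `p`-forms to `(p+1)`-forms
with coefficients in `M`. -/
def wedgeOp {n : ℕ} {M : Type} [AddCommGroup M] [Module ℂ M] (X : Fin n → M →ₗ[ℂ] M) (p : ℕ)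
    (u : MultiIndex n p → M) : MultiIndex n (p + 1) → M :=
  fun J => ∑ j : Fin n, ∑ K : MultiIndex n p, wedgeCoeff j K J • X j (u K)

/-- The index type of the coordinates `(t_1, …, t_n, x)` of `𝕋^n × 𝕋^1`. -/
abbrev Coord (n : ℕ) : Type := Fin n ⊕ Fin 1

/-- `𝕃^p = d_t + a ∧ ∂/∂x`, where `a = ∑ a_j dt_j`, on smooth `p`-forms in `dt_1, …, dt_n`
over `𝕋^n × 𝕋^1`. -/
def smoothL {n : ℕ} (a : Fin n → ℝ) (p : ℕ) (f : MultiIndex n p → Smooth (Coord n)) :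
    MultiIndex n (p + 1) → Smooth (Coord n) :=
  wedgeOp (fun j => Smooth.pderiv (Sum.inl j)) p f +
    wedgeOp (fun j => (a j : ℂ) • Smooth.pderiv (Sum.inr 0)) p f

/-- `𝕃^p = d_t + a ∧ ∂/∂x`, where `a = ∑ a_j dt_j`, on `p`-currents in `dt_1, …, dt_n`
over `𝕋^n × 𝕋^1`. -/
def currentL {n : ℕ} (a : Fin n → ℝ) (p : ℕ) (u : MultiIndex n p → Distribution (Coord n)) :
    MultiIndex n (p + 1) → Distribution (Coord n) :=
  wedgeOp (fun j => Distribution.pderiv (Sum.inl j)) p u +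
    wedgeOp (fun j => (a j : ℂ) • Distribution.pderiv (Sum.inr 0)) p u

/-- The constant form `∑ c_j dt_j` is integral: `(1/2π) ∫_σ c ∈ ℤ` for every closed curve `σ`
in `𝕋^n`, given by a lift `γ : [0, 1] → ℝ^n` with `γ(1) - γ(0) ∈ 2πℤ^n`.  -/
def IsIntegralForm {n : ℕ} (c : Fin n → ℝ) : Prop :=
  ∀ γ : ℝ → Fin n → ℝ, ContDiff ℝ 1 γ →
    (∀ j, ∃ m : ℤ, γ 1 j - γ 0 j = 2 * Real.pi * (m : ℝ)) →
    ∃ k : ℤ, 1 / (2 * Real.pi) * (∫ s in (0 : ℝ)..1, ∑ j, c j * deriv γ s j) = (k : ℝ)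

/-- The constant form `∑ a_j dt_j` is rational: some positive integer multiple is integral. -/
def IsRationalForm {n : ℕ} (a : Fin n → ℝ) : Prop :=
  ∃ q : ℕ, 0 < q ∧ IsIntegralForm (fun j => (q : ℝ) * a j)

/-- The constant form `∑ a_j dt_j` is Liouville: it is not rational and there are `C > 0` and a
sequence `(η_l, ξ_l)` in `ℤ^n × ℤ` with `|ξ_l| ≥ 2` and
`max_j |η_{l,j} + a_j ξ_l| ≤ C |(η_l, ξ_l)|^{-l}` for all `l`. -/
def IsLiouvilleForm {n : ℕ} (a : Fin n → ℝ) : Prop :=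
  ¬ IsRationalForm a ∧
    ∃ (C : ℝ) (η : ℕ → Fin n → ℤ) (ξ : ℕ → ℤ), 0 < C ∧ (∀ l, 2 ≤ |ξ l|) ∧
      ∀ (l : ℕ) (j : Fin n), |(η l j : ℝ) + a j * (ξ l : ℝ)| ≤
        C * (Real.sqrt ((∑ i, (η l i : ℝ) ^ 2) + (ξ l : ℝ) ^ 2) ^ l)⁻¹

/-- The partial Fourier coefficient `f̂(t, ξ) = (1/2π) ∫_0^{2π} f(t, x) e^{-iξx} dx`. -/
def partialFourier {n : ℕ} (f : Smooth (Coord n)) (ξ : ℤ) (t : Fin n → ℝ) : ℂ :=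
  1 / (2 * (Real.pi : ℂ)) * ∫ x in (0 : ℝ)..(2 * Real.pi),
    (f : (Coord n → ℝ) → ℂ) (Sum.elim t fun _ => x) * Complex.exp (-Complex.I * (ξ : ℂ) * (x : ℂ))

/-- The `(p+1)`-form `∑ g_J dt_J` on `𝕋^n` is exact: it is `dv` for a smooth `p`-form `v`. -/
def IsExactForm {n p : ℕ} (g : MultiIndex n (p + 1) → (Fin n → ℝ) → ℂ) : Prop :=
  ∃ v : MultiIndex n p → Smooth (Fin n), ∀ J,
    ((wedgeOp (fun j => Smooth.pderiv j) p v J : Smooth (Fin n)) : (Fin n → ℝ) → ℂ) = g J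

/-- The set `𝔼^p` of the smooth `(p+1)`-forms `f` that satisfy the compatibility conditions:
`𝕃^{p+1} f = 0`, and `f̂(t, ξ) e^{iψ(t)}` is exact on `𝕋^n` whenever `ξ a` is integral, where
`ψ` is a primitive on `ℝ^n` of (the pull-back of) `ξ a`. -/
def compatible {n : ℕ} (a : Fin n → ℝ) (p : ℕ) :
    Set (MultiIndex n (p + 1) → Smooth (Coord n)) :=
  {f | smoothL a (p + 1) f = 0 ∧
    ∀ ξ : ℤ, IsIntegralForm (fun j => (ξ : ℝ) * a j) →
      ∀ ψ : (Fin n → ℝ) → ℝ,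
        (∀ t, HasFDerivAt ψ
          (∑ j, ((ξ : ℝ) * a j) • (ContinuousLinearMap.proj j : (Fin n → ℝ) →L[ℝ] ℝ)) t) →
        IsExactForm fun J t =>
          partialFourier (f J) ξ t * Complex.exp (Complex.I * (ψ t : ℂ))}

/-- `𝕃^p` is globally solvable: every `f ∈ 𝔼^p` is `𝕃^p u` for some `p`-current `u`. -/
def GloballySolvable {n : ℕ} (a : Fin n → ℝ) (p : ℕ) : Prop :=
  ∀ f ∈ compatible a p, ∃ u : MultiIndex n p → Distribution (Coord n),
    ∀ J, Distribution.IsFunction (currentL a p u J) (f J)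

end TorusComplex

end

open scoped ContDiff

noncomputable section

namespace TorusComplex

open MeasureTheory
open scoped Pointwise

/-! At the frequency k = (η, ξ) the operator becomes i times exterior multiplication by the real
covector σ(k) with components η_j + a_j ξ (`coeff_smoothL`, `currentL_chi`). Solving the equation is
thus linear algebra at each k, plus control of the growth in k.

If σ(k) ≠ 0, closedness of f gives σ ∧ f̂ = 0. Contracting f̂ with a coordinate vector i where σ_i ≠
0 and dividing by iσ_i then gives a solution (`wedge_contract`), at the cost of a factor 1/|σ_i|. If
σ(k) = 0, then ξa is integral, and the exactness condition forces f̂(k) = 0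
(`coeff_eq_zero_of_compatible`). What remains is a small divisor problem.

When a is rational or non-Liouville, some nonzero component of σ(k) is bounded below by a negative
power of |k| (`exists_symbol_lower_bound`). The rapid decay of f̂ absorbs this loss, so the solution
has absolutely summable Fourier coefficients.

When a is Liouville, let δ be the largest |σ_j| at a frequency κ of the Liouville sequence, and put
there v = δ^{-1/2} dt_K, with K avoiding the maximizing index. The form iσ ∧ v has size of order
δ^{1/2}, which decreases rapidly, so these coefficients define a smooth f. It is compatible because
σ ∧ σ ∧ v = 0 (`wedge_wedge`) and because, a not being rational, exactness is only required at ξ =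
0, where f has no frequencies. Any solution has coefficients at least of order δ^{-1/2} at these
frequencies. This outgrows every power of |κ|, whereas a distribution has finite order
(`Distribution.exists_norm_chi_le`). -/

theorem Smooth.continuous {ι : Type} [Fintype ι] (f : Smooth ι) : Continuous (f : (ι → ℝ) → ℂ) :=
  (Smooth.contDiff f).continuous

/-! ### Integration over the torus. -/

/-- The covering map `ℝ^ι → 𝕋^ι` onto Mathlib's torus. -/
def torusMk {ι : Type} (y : ι → ℝ) : UnitAddTorus ι := fun i => (y i : UnitAddCircle)

theorem isOpenQuotientMap_torusMk {ι : Type} : IsOpenQuotientMap (torusMk (ι := ι)) :=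
  IsOpenQuotientMap.piMap fun _ => QuotientAddGroup.isOpenQuotientMap_mk

theorem torusMk_add {ι : Type} (y z : ι → ℝ) : torusMk (y + z) = torusMk y + torusMk z := rfl

theorem Smooth.eq_of_torusMk_eq {ι : Type} [Fintype ι] (f : Smooth ι) {y z : ι → ℝ} (h : torusMk y = torusMk z) :
    (f : (ι → ℝ) → ℂ) ((2 * Real.pi) • y) = (f : (ι → ℝ) → ℂ) ((2 * Real.pi) • z) := by
  have h1 : ∀ i, ∃ m : ℤ, y i = z i + m := fun i => by
    have h2 : ((y i : ℝ) : UnitAddCircle) = (z i : ℝ) := congrFun h i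
    rw [← sub_eq_zero, ← AddCircle.coe_sub, AddCircle.coe_eq_zero_iff] at h2
    obtain ⟨m, hm⟩ := h2
    refine ⟨m, ?_⟩
    rw [zsmul_one] at hm
    linarith
  choose m hm using h1
  rw [← f.2.2 ((2 * Real.pi) • z) m]
  refine congrArg (f : (ι → ℝ) → ℂ) (funext fun i => ?_)
  simp only [Pi.smul_apply, smul_eq_mul, hm]
  ring

/-- A smooth periodic function as a continuous function on Mathlib's torus. -/
def toTorus {ι : Type} [Fintype ι] (f : Smooth ι) : C(UnitAddTorus ι, ℂ) :=
  (Topology.IsQuotientMap.lift (f := ⟨torusMk, isOpenQuotientMap_torusMk.continuous⟩)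
    isOpenQuotientMap_torusMk.isQuotientMap
    ⟨fun y => (f : (ι → ℝ) → ℂ) ((2 * Real.pi) • y),
      (Smooth.continuous f).comp (continuous_const_smul _)⟩
    fun _ _ h => Smooth.eq_of_torusMk_eq f h)

@[simp]
theorem toTorus_torusMk {ι : Type} [Fintype ι] (f : Smooth ι) (y : ι → ℝ) :
    (toTorus f) (torusMk y) = (f : (ι → ℝ) → ℂ) ((2 * Real.pi) • y) :=
  ContinuousMap.congr_fun (Topology.IsQuotientMap.lift_comp
    (f := ⟨torusMk, isOpenQuotientMap_torusMk.continuous⟩)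
    isOpenQuotientMap_torusMk.isQuotientMap
    ⟨fun y => (f : (ι → ℝ) → ℂ) ((2 * Real.pi) • y),
      (Smooth.continuous f).comp (continuous_const_smul _)⟩
    fun _ _ h => Smooth.eq_of_torusMk_eq f h) y

/-- The normalized Haar measure of Mathlib's torus. -/
def torusMeasure (ι : Type) [Fintype ι] : Measure (UnitAddTorus ι) :=
  Measure.pi fun _ => AddCircle.haarAddCircle

instance {ι : Type} [Fintype ι] : Measure.IsAddLeftInvariant (torusMeasure ι) :=
  inferInstanceAs (Measure.IsAddLeftInvariant (Measure.pi fun _ => AddCircle.haarAddCircle))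

instance {ι : Type} [Fintype ι] : IsProbabilityMeasure (torusMeasure ι) :=
  inferInstanceAs (IsProbabilityMeasure (Measure.pi fun _ => AddCircle.haarAddCircle))

/-- Rescaling by 2π turns the closed box into the half-open unit box over which
`UnitAddTorus.integral_preimage` integrates; the two boxes differ by a null set. -/
theorem setIntegral_box_eq {ι : Type} [Fintype ι] (g : (ι → ℝ) → ℂ) :
    ∫ x in Set.Icc (0 : ι → ℝ) (fun _ => 2 * Real.pi), g x =
      ((2 * Real.pi) ^ Fintype.card ι : ℝ) •
        ∫ y in {y : ι → ℝ | ∀ i, y i ∈ Set.Ioc ((0 : ι → ℝ) i) ((0 : ι → ℝ) i + 1)},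
          g ((2 * Real.pi) • y) := by
  have h2π : (0 : ℝ) < 2 * Real.pi := by positivity
  rw [Measure.setIntegral_comp_smul_of_pos volume g _ h2π, Module.finrank_fintype_fun_eq_card,
    smul_smul, mul_inv_cancel₀ (by positivity), one_smul]
  have h : (2 * Real.pi) • {y : ι → ℝ | ∀ i, y i ∈ Set.Ioc ((0 : ι → ℝ) i) ((0 : ι → ℝ) i + 1)} =
      Set.univ.pi fun _ => Set.Ioc 0 (2 * Real.pi) := by
    ext x
    rw [Set.mem_smul_set_iff_inv_smul_mem₀ h2π.ne']
    simp only [Set.mem_ofPred_eq, Set.mem_pi, Set.mem_univ, true_imp_iff, Pi.smul_apply,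
      smul_eq_mul, Set.mem_Ioc, Pi.zero_apply, zero_add]
    refine forall_congr' fun i => and_congr ?_ ?_
    · rw [mul_pos_iff_of_pos_left (inv_pos.2 h2π)]
    · rw [inv_mul_le_iff₀ h2π, mul_one]
  rw [h]
  exact (setIntegral_congr_set Measure.univ_pi_Ioc_ae_eq_Icc).symm

theorem Smooth.setIntegral_box {ι : Type} [Fintype ι] (f : Smooth ι) :
    ∫ x in Set.Icc (0 : ι → ℝ) (fun _ => 2 * Real.pi), (f : (ι → ℝ) → ℂ) x =
      ((2 * Real.pi) ^ Fintype.card ι : ℝ) • ∫ z, (toTorus f) z ∂(torusMeasure ι) := by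
  rw [setIntegral_box_eq]
  simp only [← toTorus_torusMk]
  congr 1
  exact (UnitAddTorus.integral_preimage (fun z => (toTorus f) z) 0).symm

theorem Smooth.hasDerivAt_line {ι : Type} [Fintype ι] [DecidableEq ι] (f : Smooth ι) (i : ι) (x : ι → ℝ) (r s : ℝ) :
    HasDerivAt (fun s : ℝ => (f : (ι → ℝ) → ℂ) (x + (r * s) • Pi.single i 1))
      (r * (Smooth.pderiv i f : (ι → ℝ) → ℂ) (x + (r * s) • Pi.single i 1)) s := by
  have h1 : HasDerivAt (fun s : ℝ => x + (r * s) • (Pi.single i 1 : ι → ℝ))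
      (r • (Pi.single i 1 : ι → ℝ)) s := by
    simpa using (((hasDerivAt_id s).const_mul r).smul_const (Pi.single i 1 : ι → ℝ)).const_add x
  have h2 := ((Smooth.differentiable f) (x + (r * s) • Pi.single i 1)).hasFDerivAt.comp_hasDerivAt
    s h1
  rw [map_smul, Complex.real_smul] at h2
  exact h2

/-- The integral of a partial derivative over the torus vanishes. -/
theorem Smooth.setIntegral_box_pderiv {ι : Type} [Fintype ι] [DecidableEq ι] (i : ι) (f : Smooth ι) :
    ∫ x in Set.Icc (0 : ι → ℝ) (fun _ => 2 * Real.pi), (Smooth.pderiv i f : (ι → ℝ) → ℂ) x = 0 := by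
  rw [Smooth.setIntegral_box]
  set g := Smooth.pderiv i f
  let e : ℝ → UnitAddTorus ι := fun s => torusMk (s • Pi.single i 1)
  -- By translation invariance this function of s is constant, so its derivative, computed under the
  -- integral sign, must vanish.
  have key : HasDerivAt (fun s : ℝ => ∫ z, (toTorus f) (e s + z) ∂(torusMeasure ι))
      (∫ z, (2 * Real.pi : ℝ) * (toTorus g) (e 0 + z) ∂(torusMeasure ι)) 0 := by
    refine (hasDerivAt_integral_of_dominated_loc_of_deriv_le (s := Set.univ)
      (F := fun s z => (toTorus f) (e s + z))
      (F' := fun s z => (2 * Real.pi : ℝ) * (toTorus g) (e s + z))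
      (bound := fun _ => 2 * Real.pi * ‖(toTorus g)‖) Filter.univ_mem
      (.of_forall fun s => ?_) ?_ ?_ ?_ (integrable_const _) ?_).2
    · exact ((toTorus f).continuous.comp (continuous_const_add _)).aestronglyMeasurable
    · exact ((toTorus f).continuous.comp (continuous_const_add _)).integrable_of_hasCompactSupport
        (HasCompactSupport.of_compactSpace _)
    · exact (continuous_const.mul
        ((toTorus g).continuous.comp (continuous_const_add _))).aestronglyMeasurable
    · refine .of_forall fun z s _ => ?_
      rw [norm_mul, Complex.norm_real, Real.norm_of_nonneg (by positivity)]
      gcongr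
      exact (toTorus g).norm_coe_le_norm _
    · refine .of_forall fun z s _ => ?_
      obtain ⟨y, rfl⟩ := isOpenQuotientMap_torusMk.surjective z
      have h := Smooth.hasDerivAt_line f i ((2 * Real.pi) • y) (2 * Real.pi) s
      simp only [e, ← torusMk_add, toTorus_torusMk]
      have h3 : ∀ s : ℝ, (2 * Real.pi) • (s • (Pi.single i 1 : ι → ℝ) + y) =
          (2 * Real.pi) • y + (2 * Real.pi * s) • Pi.single i 1 := fun s => by
        rw [smul_add, smul_smul, add_comm]
      simp only [h3]
      exact h
  simp only [integral_add_left_eq_self (μ := torusMeasure ι) (fun z => (toTorus f) z)] at key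
  have h0 := key.unique (hasDerivAt_const _ _)
  rw [integral_const_mul, integral_add_left_eq_self (μ := torusMeasure ι)
    (fun z => (toTorus g) z)] at h0
  have h2π : ((2 * Real.pi : ℝ) : ℂ) ≠ 0 := by
    exact_mod_cast (by positivity : (2 * Real.pi : ℝ) ≠ 0)
  rw [(mul_eq_zero.1 h0).resolve_left h2π, smul_zero]

/-! ### Characters of the torus. -/

/-- The linear form `x ↦ k · x`. -/
def freq {ι : Type} [Fintype ι] (k : ι → ℤ) : (ι → ℝ) →L[ℝ] ℝ :=
  ∑ i, (k i : ℝ) • (ContinuousLinearMap.proj i : (ι → ℝ) →L[ℝ] ℝ)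

theorem freq_apply {ι : Type} [Fintype ι] (k : ι → ℤ) (x : ι → ℝ) :
    freq k x = ∑ i, (k i : ℝ) * x i := by
  simp [freq]

theorem norm_freq_le {ι : Type} [Fintype ι] (k : ι → ℤ) :
    ‖freq k‖ ≤ Fintype.card ι * ‖k‖ := by
  refine ContinuousLinearMap.opNorm_le_bound _ (by positivity) fun x => ?_
  rw [freq_apply]
  refine (norm_sum_le _ _).trans ?_
  have h : ∀ i ∈ Finset.univ, ‖(k i : ℝ) * x i‖ ≤ ‖k‖ * ‖x‖ := fun i _ => by
    rw [norm_mul, Int.norm_cast_real]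
    exact mul_le_mul (norm_le_pi_norm k i) (norm_le_pi_norm x i) (norm_nonneg _) (norm_nonneg _)
  refine (Finset.sum_le_card_nsmul _ _ _ h).trans (le_of_eq ?_)
  rw [nsmul_eq_mul, Finset.card_univ, mul_assoc]

/-- The character `x ↦ e^{ik·x}`. -/
def chi {ι : Type} [Fintype ι] (k : ι → ℤ) : Smooth ι :=
  ⟨fun x => Complex.exp (Complex.I * (freq k x : ℂ)), by
    refine ⟨(contDiff_const.mul (Complex.ofRealCLM.contDiff.comp (freq k).contDiff)).cexp,
      fun x m => ?_⟩
    rw [Complex.exp_eq_exp_iff_exists_int]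
    refine ⟨∑ i, k i * m i, ?_⟩
    simp only [freq_apply]
    push_cast
    simp only [mul_add, Finset.sum_add_distrib, Finset.mul_sum, Finset.sum_mul]
    congr 1
    refine Finset.sum_congr rfl fun i _ => ?_
    ring⟩

theorem chi_apply {ι : Type} [Fintype ι] (k : ι → ℤ) (x : ι → ℝ) :
    (chi k : (ι → ℝ) → ℂ) x = Complex.exp (Complex.I * (freq k x : ℂ)) :=
  rfl

@[simp]
theorem norm_chi {ι : Type} [Fintype ι] (k : ι → ℤ) (x : ι → ℝ) :
    ‖(chi k : (ι → ℝ) → ℂ) x‖ = 1 := by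
  rw [chi_apply, mul_comm, Complex.norm_exp_ofReal_mul_I]

theorem chi_neg_mul_chi {ι : Type} [Fintype ι] (k : ι → ℤ) (x : ι → ℝ) :
    (chi k : (ι → ℝ) → ℂ) x * (chi (-k) : (ι → ℝ) → ℂ) x = 1 := by
  have h : freq (-k) x = -freq k x := by simp [freq_apply]
  rw [chi_apply, chi_apply, ← Complex.exp_add, h]
  simp

theorem pderiv_chi {ι : Type} [Fintype ι] [DecidableEq ι] (i : ι) (k : ι → ℤ) :
    Smooth.pderiv i (chi k) = (Complex.I * (k i : ℂ)) • chi k := by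
  refine Subtype.ext (funext fun x => ?_)
  have h : HasFDerivAt (fun x => Complex.exp (Complex.I * (freq k x : ℂ))) _ x :=
    (((Complex.ofRealCLM.hasFDerivAt (x := freq k x)).comp x
      (freq k).hasFDerivAt).const_mul Complex.I).cexp
  change fderiv ℝ (fun x => Complex.exp (Complex.I * (freq k x : ℂ))) x (Pi.single i 1) = _
  rw [h.fderiv]
  have hs : freq k (Pi.single i 1) = k i := by
    simp [freq_apply, Pi.single_apply]
  simp [hs, chi_apply]
  ring

/-- The character is s ↦ e^{is}, all of whose derivatives have modulus one, composed with a linear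
form; each differentiation costs one factor of the norm of that form. -/
theorem norm_iteratedFDeriv_chi_le {ι : Type} [Fintype ι] (k : ι → ℤ) (j : ℕ) (x : ι → ℝ) :
    ‖iteratedFDeriv ℝ j (chi k : (ι → ℝ) → ℂ) x‖ ≤ (Fintype.card ι * ‖k‖) ^ j := by
  have hg : ContDiff ℝ ∞ fun s : ℝ => Complex.exp (Complex.I * (s : ℂ)) :=
    (contDiff_const.mul Complex.ofRealCLM.contDiff).cexp
  have h1 : ∀ s : ℝ, ‖iteratedFDeriv ℝ j (fun s : ℝ => Complex.exp (Complex.I * (s : ℂ))) s‖ = 1 := by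
    intro s
    rw [norm_iteratedFDeriv_eq_norm_iteratedDeriv]
    have h2 : iteratedDeriv j (fun s : ℝ => Complex.exp (Complex.I * (s : ℂ))) =
        fun s : ℝ => Complex.I ^ j * Complex.exp (Complex.I * (s : ℂ)) := by
      induction j with
      | zero => simp
      | succ j ih =>
        rw [iteratedDeriv_succ, ih]
        funext s
        have h3 : HasDerivAt (fun s : ℝ => Complex.I ^ j * Complex.exp (Complex.I * (s : ℂ))) _ s :=
          (((Complex.ofRealCLM.hasDerivAt (x := s)).const_mul Complex.I).cexp).const_mul _
        rw [h3.deriv]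
        simp [pow_succ]
        ring
    rw [h2, norm_mul, norm_pow, Complex.norm_I, one_pow, one_mul, mul_comm,
      Complex.norm_exp_ofReal_mul_I]
  have h := (freq k).iteratedFDeriv_comp_right hg x (i := j) (by exact_mod_cast le_top)
  change ‖iteratedFDeriv ℝ j ((fun s : ℝ => Complex.exp (Complex.I * (s : ℂ))) ∘ freq k) x‖ ≤ _
  rw [h]
  refine (ContinuousMultilinearMap.norm_compContinuousLinearMap_le _ _).trans ?_
  rw [h1, one_mul, Finset.prod_const, Finset.card_univ, Fintype.card_fin]
  exact pow_le_pow_left₀ (norm_nonneg _) (norm_freq_le k) j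

/-! ### Integration by parts and Fourier coefficients. -/

/-- The product of smooth periodic functions. -/
def Smooth.mul {ι : Type} [Fintype ι] (f g : Smooth ι) : Smooth ι :=
  ⟨fun x => (f : (ι → ℝ) → ℂ) x * (g : (ι → ℝ) → ℂ) x,
    f.2.1.mul g.2.1, fun x k => congrArg₂ (· * ·) (f.2.2 x k) (g.2.2 x k)⟩

theorem Smooth.pderiv_mul {ι : Type} [Fintype ι] [DecidableEq ι] (i : ι) (f g : Smooth ι) :
    Smooth.pderiv i (Smooth.mul f g) =
      Smooth.mul f (Smooth.pderiv i g) + Smooth.mul (Smooth.pderiv i f) g := by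
  refine Subtype.ext (funext fun x => ?_)
  have h := fderiv_fun_mul (Smooth.differentiable f x) (Smooth.differentiable g x)
  change fderiv ℝ (fun x => (f : (ι → ℝ) → ℂ) x * (g : (ι → ℝ) → ℂ) x) x (Pi.single i 1) = _
  rw [h]
  simp [Smooth.mul, Smooth.pderiv]
  ring

/-- The fundamental box `[0, 2π]^ι`. -/
def box (ι : Type) : Set (ι → ℝ) := Set.Icc (0 : ι → ℝ) (fun _ => 2 * Real.pi)

theorem isCompact_box (ι : Type) [Fintype ι] : IsCompact (box ι) := isCompact_Icc

theorem measureReal_box (ι : Type) [Fintype ι] :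
    volume.real (box ι) = (2 * Real.pi) ^ Fintype.card ι := by
  have h : (0 : ι → ℝ) ≤ fun _ => 2 * Real.pi := fun i => by
    change (0 : ℝ) ≤ 2 * Real.pi
    positivity
  rw [box, measureReal_def, Real.volume_Icc_pi_toReal h]
  simp

theorem Smooth.integrableOn_mul {ι : Type} [Fintype ι] (f g : Smooth ι) :
    IntegrableOn (fun x => (f : (ι → ℝ) → ℂ) x * (g : (ι → ℝ) → ℂ) x) (box ι) :=
  ((Smooth.continuous f).mul (Smooth.continuous g)).continuousOn.integrableOn_compact
    (isCompact_box ι)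

/-- The pairing `∫ f g` over the torus. -/
def pairing {ι : Type} [Fintype ι] (g : Smooth ι) : Smooth ι →ₗ[ℂ] ℂ where
  toFun f := ∫ x in box ι, (f : (ι → ℝ) → ℂ) x * (g : (ι → ℝ) → ℂ) x
  map_add' f h := by
    rw [← integral_add (Smooth.integrableOn_mul f g) (Smooth.integrableOn_mul h g)]
    simp [add_mul]
  map_smul' c f := by
    rw [RingHom.id_apply, ← integral_smul]
    simp [mul_assoc]

theorem pairing_apply {ι : Type} [Fintype ι] (g f : Smooth ι) :
    pairing g f = ∫ x in box ι, (f : (ι → ℝ) → ℂ) x * (g : (ι → ℝ) → ℂ) x :=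
  rfl

theorem pairing_comm {ι : Type} [Fintype ι] (f g : Smooth ι) : pairing g f = pairing f g := by
  simp only [pairing_apply, mul_comm]

theorem norm_pairing_le {ι : Type} [Fintype ι] (f g : Smooth ι) {A B : ℝ}
    (hf : ∀ x, ‖(f : (ι → ℝ) → ℂ) x‖ ≤ A) (hg : ∀ x, ‖(g : (ι → ℝ) → ℂ) x‖ ≤ B) :
    ‖pairing g f‖ ≤ A * B * (2 * Real.pi) ^ Fintype.card ι := by
  rw [← measureReal_box]
  refine norm_setIntegral_le_of_norm_le_const (isCompact_box ι).measure_lt_top fun x _ => ?_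
  rw [norm_mul]
  exact mul_le_mul (hf x) (hg x) (norm_nonneg _) ((norm_nonneg _).trans (hf x))

/-- Integration by parts. -/
theorem pairing_pderiv {ι : Type} [Fintype ι] [DecidableEq ι] (i : ι) (f g : Smooth ι) :
    pairing g (Smooth.pderiv i f) = -pairing (Smooth.pderiv i g) f := by
  have h := Smooth.setIntegral_box_pderiv i (Smooth.mul f g)
  rw [Smooth.pderiv_mul] at h
  have h2 := integral_add (Smooth.integrableOn_mul f (Smooth.pderiv i g))
    (Smooth.integrableOn_mul (Smooth.pderiv i f) g)
  rw [eq_neg_iff_add_eq_zero, add_comm]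
  exact h2.symm.trans h

/-- The Fourier coefficients of a smooth periodic function. -/
def coeff {ι : Type} [Fintype ι] (k : ι → ℤ) : Smooth ι →ₗ[ℂ] ℂ :=
  (((2 * Real.pi) ^ Fintype.card ι : ℝ) : ℂ)⁻¹ • pairing (chi (-k))

theorem two_pi_pow_ne_zero (m : ℕ) : (((2 * Real.pi) ^ m : ℝ) : ℂ) ≠ 0 := by
  exact_mod_cast (by positivity : ((2 * Real.pi) ^ m : ℝ) ≠ 0)

theorem pairing_chi_neg {ι : Type} [Fintype ι] (k : ι → ℤ) (f : Smooth ι) :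
    pairing (chi (-k)) f = (((2 * Real.pi) ^ Fintype.card ι : ℝ) : ℂ) * coeff k f := by
  rw [coeff, LinearMap.smul_apply, smul_eq_mul, mul_inv_cancel_left₀ (two_pi_pow_ne_zero _)]

theorem coeff_pderiv {ι : Type} [Fintype ι] [DecidableEq ι] (i : ι) (k : ι → ℤ) (f : Smooth ι) :
    coeff k (Smooth.pderiv i f) = Complex.I * (k i : ℂ) * coeff k f := by
  rw [coeff, LinearMap.smul_apply, LinearMap.smul_apply, pairing_pderiv, pairing_comm, pderiv_chi,
    map_smul, pairing_comm]
  simp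
  ring

/-- Orthogonality comes from differentiation: `∂_i` multiplies the coefficient both by i k_i and by
i l_i, so it vanishes as soon as these differ for some i. -/
theorem coeff_chi {ι : Type} [Fintype ι] [DecidableEq ι] (k l : ι → ℤ) :
    coeff k (chi l) = if k = l then 1 else 0 := by
  split_ifs with h
  · subst h
    have h1 : pairing (chi (-k)) (chi k) = (((2 * Real.pi) ^ Fintype.card ι : ℝ) : ℂ) := by
      simp only [pairing_apply, chi_neg_mul_chi]
      rw [setIntegral_const, measureReal_box]
      simp
    rw [coeff, LinearMap.smul_apply, h1, smul_eq_mul, inv_mul_cancel₀ (two_pi_pow_ne_zero _)]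
  · obtain ⟨i, hi⟩ := Function.ne_iff.1 h
    have h1 := coeff_pderiv i k (chi l)
    rw [pderiv_chi, map_smul, smul_eq_mul, ← sub_eq_zero, ← sub_mul, ← mul_sub] at h1
    refine (mul_eq_zero.1 h1).resolve_left (mul_ne_zero Complex.I_ne_zero ?_)
    rw [sub_ne_zero]
    exact_mod_cast Ne.symm hi

theorem Smooth.exists_norm_le {ι : Type} [Fintype ι] (f : Smooth ι) :
    ∃ C, ∀ x, ‖(f : (ι → ℝ) → ℂ) x‖ ≤ C := by
  refine ⟨‖toTorus f‖, fun x => ?_⟩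
  have h := (toTorus f).norm_coe_le_norm (torusMk ((2 * Real.pi)⁻¹ • x))
  rwa [toTorus_torusMk, smul_inv_smul₀ (by positivity)] at h

theorem Smooth.exists_norm_coeff_le {ι : Type} [Fintype ι] (f : Smooth ι) :
    ∃ C, ∀ k, ‖coeff k f‖ ≤ C := by
  obtain ⟨C, hC⟩ := Smooth.exists_norm_le f
  refine ⟨C, fun k => ?_⟩
  rw [coeff, LinearMap.smul_apply, norm_smul, norm_inv, Complex.norm_real,
    Real.norm_of_nonneg (by positivity), inv_mul_le_iff₀ (by positivity), mul_comm]
  simpa using norm_pairing_le f (chi (-k)) hC fun x => (norm_chi _ _).le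

theorem coeff_pderiv_iterate {ι : Type} [Fintype ι] [DecidableEq ι] (i : ι) (k : ι → ℤ)
    (f : Smooth ι) (m : ℕ) :
    coeff k ((Smooth.pderiv i)^[m] f) = (Complex.I * (k i : ℂ)) ^ m * coeff k f := by
  induction m with
  | zero => simp
  | succ m ih =>
    rw [Function.iterate_succ_apply', coeff_pderiv, ih, pow_succ']
    ring

/-- Differentiating m times in the coordinate where |k_i| attains the sup norm of k produces the
factor ‖k‖^m. Summing the bounds over all coordinates makes the constant independent of k. -/
theorem exists_norm_pow_mul_norm_coeff_le {ι : Type} [Fintype ι] (f : Smooth ι) (m : ℕ) :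
    ∃ C, ∀ k : ι → ℤ, ‖k‖ ^ m * ‖coeff k f‖ ≤ C := by
  classical
  choose C hC using fun i : ι => Smooth.exists_norm_coeff_le ((Smooth.pderiv i)^[m] f)
  obtain ⟨C', hC'⟩ := Smooth.exists_norm_coeff_le f
  have hC0 : ∀ i, 0 ≤ C i := fun i => (norm_nonneg _).trans (hC i 0)
  refine ⟨(∑ i, C i) + C', fun k => ?_⟩
  have hC'0 : 0 ≤ C' := (norm_nonneg _).trans (hC' 0)
  rcases isEmpty_or_nonempty ι with h | h
  · refine (mul_le_of_le_one_left (norm_nonneg _) ?_).trans ((hC' k).trans (by simp))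
    exact pow_le_one₀ (norm_nonneg _) (by simp [Subsingleton.elim k 0])
  · obtain ⟨i, hi⟩ := Finite.exists_max fun i => ‖k i‖
    have hi' : ‖k‖ ≤ ‖k i‖ := (pi_norm_le_iff_of_nonneg (norm_nonneg _)).2 hi
    have h1 := hC i k
    rw [coeff_pderiv_iterate, norm_mul, norm_pow, norm_mul, Complex.norm_I, one_mul,
      Complex.norm_intCast, ← Int.norm_eq_abs] at h1
    refine (mul_le_mul_of_nonneg_right (pow_le_pow_left₀ (norm_nonneg _) hi' m)
      (norm_nonneg _)).trans ?_
    exact h1.trans ((Finset.single_le_sum (fun i _ => hC0 i) (Finset.mem_univ i)).trans (by linarith))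

/-! ### Rapid decay and Fourier series. -/

theorem summable_norm_inv_pow_int (ι : Type) [Fintype ι] :
    ∃ d : ℕ, Summable fun k : ι → ℤ => (‖k‖⁻¹) ^ d := by
  classical
  let L : Submodule ℤ (ι → ℝ) := Submodule.span ℤ (Set.range (Pi.basisFun ℝ ι))
  refine ⟨Module.finrank ℤ L + 1, ?_⟩
  have hmem : ∀ k : ι → ℤ, (fun i => (k i : ℝ)) ∈ L := fun k =>
    ((Pi.basisFun ℝ ι).mem_span_iff_repr_mem ℤ _).2 fun i => ⟨k i, by simp⟩
  have h := ZLattice.summable_norm_pow_inv L (Module.finrank ℤ L + 1) (Nat.lt_succ_self _)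
  let e : (ι → ℤ) → L := fun k => ⟨fun i => (k i : ℝ), hmem k⟩
  have he : Function.Injective e := fun k l hkl => funext fun i => by
    have : (k i : ℝ) = l i := congrFun (congrArg Subtype.val hkl) i
    exact_mod_cast this
  have h2 := h.comp_injective he
  have hn : ∀ k, ‖e k‖ = ‖k‖ := fun k => by
    change ‖(fun i => (k i : ℝ))‖ = ‖k‖
    simp only [Pi.norm_def]
    rfl
  simpa only [Function.comp_def, hn] using h2

theorem summable_norm_pow_mul_of_bounded {ι : Type} [Fintype ι] {c : (ι → ℤ) → ℂ}
    (hc : ∀ m : ℕ, ∃ C, ∀ k, ‖k‖ ^ m * ‖c k‖ ≤ C) (m : ℕ) :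
    Summable fun k => ‖k‖ ^ m * ‖c k‖ := by
  obtain ⟨d, hd⟩ := summable_norm_inv_pow_int ι
  -- The d extra powers are traded for the summable weight ‖k‖^{-d}; the frequency 0 is left out
  -- because its norm cannot be inverted.
  obtain ⟨C, hC⟩ := hc (m + d)
  refine Summable.of_norm_bounded_eventually (hd.mul_left C) ?_
  filter_upwards [(Set.finite_singleton (0 : ι → ℤ)).compl_mem_cofinite] with k hk
  have hk0 : 0 < ‖k‖ := norm_pos_iff.2 hk
  rw [Real.norm_of_nonneg (by positivity), inv_pow, ← div_eq_mul_inv, le_div_iff₀ (by positivity)]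
  refine le_trans (le_of_eq ?_) (hC k)
  ring

/-- The Fourier coefficients of a smooth function decrease rapidly. -/
theorem summable_norm_pow_mul_norm_coeff {ι : Type} [Fintype ι] (f : Smooth ι) (m : ℕ) :
    Summable fun k : ι → ℤ => ‖k‖ ^ m * ‖coeff k f‖ :=
  summable_norm_pow_mul_of_bounded (exists_norm_pow_mul_norm_coeff_le f) m

theorem summable_norm_coeff {ι : Type} [Fintype ι] (f : Smooth ι) :
    Summable fun k : ι → ℤ => ‖coeff k f‖ := by
  simpa using summable_norm_pow_mul_norm_coeff f 0

theorem mFourier_torusMk {ι : Type} [Fintype ι] (k : ι → ℤ) (y : ι → ℝ) :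
    UnitAddTorus.mFourier k (torusMk y) = (chi k : (ι → ℝ) → ℂ) ((2 * Real.pi) • y) := by
  rw [chi_apply, freq_apply]
  change ∏ i, fourier (k i) (y i : UnitAddCircle) = _
  simp only [fourier_coe_apply, ← Complex.exp_sum]
  congr 1
  push_cast
  rw [Finset.mul_sum]
  refine Finset.sum_congr rfl fun i _ => ?_
  simp
  ring

/-- This identification makes the inversion theorem for summable Fourier series on `UnitAddTorus`
available. -/
theorem coeff_eq_mFourierCoeff {ι : Type} [Fintype ι] (k : ι → ℤ) (f : Smooth ι) :
    coeff k f = UnitAddTorus.mFourierCoeff (toTorus f) k := by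
  have h : pairing (chi (-k)) f = _ := Smooth.setIntegral_box (Smooth.mul f (chi (-k)))
  have h2 : ∀ z, toTorus (Smooth.mul f (chi (-k))) z =
      UnitAddTorus.mFourier (-k) z • toTorus f z := fun z => by
    obtain ⟨y, rfl⟩ := isOpenQuotientMap_torusMk.surjective z
    rw [toTorus_torusMk, toTorus_torusMk, mFourier_torusMk, smul_eq_mul]
    exact mul_comm _ _
  simp only [h2] at h
  rw [coeff, LinearMap.smul_apply, h, smul_eq_mul, Complex.real_smul,
    inv_mul_cancel_left₀ (two_pi_pow_ne_zero _)]
  rfl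

/-- A smooth function is the sum of its Fourier series. -/
theorem hasSum_coeff_mul_chi {ι : Type} [Fintype ι] (f : Smooth ι) (x : ι → ℝ) :
    HasSum (fun k => coeff k f * (chi k : (ι → ℝ) → ℂ) x) ((f : (ι → ℝ) → ℂ) x) := by
  have hs : Summable (UnitAddTorus.mFourierCoeff (toTorus f)) := by
    exact (summable_norm_coeff f).of_norm.congr fun k => coeff_eq_mFourierCoeff k f
  have h := UnitAddTorus.hasSum_mFourier_series_apply_of_summable hs
    (torusMk ((2 * Real.pi)⁻¹ • x))
  simpa only [← coeff_eq_mFourierCoeff, toTorus_torusMk, mFourier_torusMk,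
    smul_inv_smul₀ (by positivity : (2 * Real.pi) ≠ 0), smul_eq_mul] using h

theorem Smooth.eq_zero_of_coeff_eq_zero {ι : Type} [Fintype ι] {f : Smooth ι}
    (h : ∀ k, coeff k f = 0) : f = 0 := by
  refine Subtype.ext (funext fun x => ?_)
  have h1 := hasSum_coeff_mul_chi f x
  simp only [h, zero_mul] at h1
  exact h1.unique hasSum_zero

/-- Characters have modulus one, so absolute summability of c justifies integrating term by term.
The c_k are not assumed to be the Fourier coefficients of f, so that `coeff_ofCoeff` can be derived
from it. -/
theorem hasSum_pairing {ι : Type} [Fintype ι] {c : (ι → ℤ) → ℂ} (hc : Summable fun k => ‖c k‖)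
    {f : Smooth ι} (hf : ∀ x, HasSum (fun k => c k * (chi k : (ι → ℝ) → ℂ) x) ((f : (ι → ℝ) → ℂ) x))
    (g : Smooth ι) : HasSum (fun k => c k * pairing g (chi k)) (pairing g f) := by
  obtain ⟨B, hB⟩ := Smooth.exists_norm_le g
  have h := hasSum_integral_of_summable_integral_norm (μ := volume.restrict (box ι))
    (F := fun k x => c k * ((chi k : (ι → ℝ) → ℂ) x * (g : (ι → ℝ) → ℂ) x))
    (fun k => (Smooth.integrableOn_mul (chi k) g).const_mul _) ?_
  · have h3 : ∀ x, ∑' k, c k * ((chi k : (ι → ℝ) → ℂ) x * (g : (ι → ℝ) → ℂ) x) =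
        (f : (ι → ℝ) → ℂ) x * (g : (ι → ℝ) → ℂ) x := fun x => by
      simpa only [mul_assoc] using ((hf x).mul_right ((g : (ι → ℝ) → ℂ) x)).tsum_eq
    simp only [h3, integral_const_mul] at h
    exact h
  · refine Summable.of_nonneg_of_le (fun k => integral_nonneg fun x => norm_nonneg _) (fun k => ?_)
      (hc.mul_right (B * (2 * Real.pi) ^ Fintype.card ι))
    have h2 : ‖∫ x in box ι, ‖c k * ((chi k : (ι → ℝ) → ℂ) x * (g : (ι → ℝ) → ℂ) x)‖‖ ≤
        ‖c k‖ * B * volume.real (box ι) := by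
      refine norm_setIntegral_le_of_norm_le_const (isCompact_box ι).measure_lt_top fun x _ => ?_
      rw [norm_norm, norm_mul, norm_mul, norm_chi, one_mul]
      exact mul_le_mul_of_nonneg_left (hB x) (norm_nonneg _)
    rw [measureReal_box, mul_assoc] at h2
    exact (le_abs_self _).trans h2

/-- The smooth function with given rapidly decreasing Fourier coefficients. -/
def Smooth.ofCoeff {ι : Type} [Fintype ι] (c : (ι → ℤ) → ℂ)
    (hc : ∀ m : ℕ, Summable fun k => ‖k‖ ^ m * ‖c k‖) : Smooth ι :=
  ⟨fun x => ∑' k, c k * (chi k : (ι → ℝ) → ℂ) x, by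
    refine ⟨contDiff_tsum (𝕜 := ℝ) (N := ⊤)
      (v := fun j k => (Fintype.card ι : ℝ) ^ j * (‖k‖ ^ j * ‖c k‖))
      (fun k => contDiff_const.mul (Smooth.contDiff (chi k))) (fun j _ => (hc j).mul_left _)
      fun j k x _ => ?_, fun x m => ?_⟩
    · have h := iteratedFDeriv_const_smul_apply (𝕜 := ℝ) (i := j) (x := x) (a := c k)
        (f := (chi k : (ι → ℝ) → ℂ))
        ((Smooth.contDiff (chi k)).contDiffAt.of_le (by exact_mod_cast le_top))
      change ‖iteratedFDeriv ℝ j (c k • (chi k : (ι → ℝ) → ℂ)) x‖ ≤ _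
      rw [h, norm_smul]
      refine (mul_le_mul_of_nonneg_left (norm_iteratedFDeriv_chi_le k j x) (norm_nonneg _)).trans
        (le_of_eq ?_)
      ring
    · exact tsum_congr fun k => by rw [(chi k).2.2]⟩

theorem summable_norm_of_rapid {ι : Type} [Fintype ι] {c : (ι → ℤ) → ℂ}
    (hc : ∀ m : ℕ, Summable fun k => ‖k‖ ^ m * ‖c k‖) : Summable fun k => ‖c k‖ := by
  simpa using hc 0

theorem coeff_ofCoeff {ι : Type} [Fintype ι] (c : (ι → ℤ) → ℂ)
    (hc : ∀ m : ℕ, Summable fun k => ‖k‖ ^ m * ‖c k‖) (k : ι → ℤ) :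
    coeff k (Smooth.ofCoeff c hc) = c k := by
  classical
  have h0 := summable_norm_of_rapid hc
  have h := hasSum_pairing h0 (f := Smooth.ofCoeff c hc) (fun x => ?_) (chi (-k))
  · simp only [pairing_chi_neg, coeff_chi] at h
    have h1 := h.unique (hasSum_single k fun l hl => by simp [Ne.symm hl])
    simp only [if_true, mul_one] at h1
    rw [mul_comm] at h1
    exact mul_right_cancel₀ (two_pi_pow_ne_zero _) h1
  · refine (Summable.of_norm ?_).hasSum
    simpa only [norm_mul, norm_chi, mul_one] using h0

/-! ### Exterior algebra with constant coefficients. -/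

/-- The sign of `dt_j` with respect to its position in `S`. -/
def eps {n : ℕ} (j : Fin n) (S : Finset (Fin n)) : ℂ := (-1) ^ (S.filter (· < j)).card

theorem eps_mul_self {n : ℕ} (j : Fin n) (S : Finset (Fin n)) : eps j S * eps j S = 1 := by
  rw [eps, ← mul_pow]
  simp

theorem norm_eps {n : ℕ} (j : Fin n) (S : Finset (Fin n)) : ‖eps j S‖ = 1 := by
  simp [eps]

theorem eps_erase_of_not_lt {n : ℕ} {i j : Fin n} (h : ¬ i < j) (S : Finset (Fin n)) :
    eps j (S.erase i) = eps j S := by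
  rw [eps, eps, Finset.filter_erase, Finset.erase_eq_of_notMem (by simp [h])]

theorem eps_erase_of_lt {n : ℕ} {i j : Fin n} (h : i < j) {S : Finset (Fin n)} (hi : i ∈ S) :
    eps j (S.erase i) = -eps j S := by
  have hm : i ∈ S.filter (· < j) := by simp [hi, h]
  rw [eps, eps, Finset.filter_erase, ← Finset.card_erase_add_one hm, pow_succ]
  ring

/-- Deleting one of two indices flips only the sign of the larger one, so exactly one of the two
factors changes. -/
theorem eps_erase_mul_eps_erase {n : ℕ} {i j : Fin n} (hij : i ≠ j) {S : Finset (Fin n)}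
    (hi : i ∈ S) (hj : j ∈ S) :
    eps j (S.erase i) * eps i (S.erase j) = -(eps j S * eps i S) := by
  rcases lt_or_gt_of_ne hij with h | h
  · rw [eps_erase_of_lt h hi, eps_erase_of_not_lt h.asymm]
    ring
  · rw [eps_erase_of_lt h hj, eps_erase_of_not_lt h.asymm]
    ring

theorem eps_mul_eps_erase {n : ℕ} {i j : Fin n} (hij : i ≠ j) {S : Finset (Fin n)}
    (hi : i ∈ S) (hj : j ∈ S) :
    eps j S * eps i (S.erase j) = -(eps i S * eps j (S.erase i)) := by
  rcases lt_or_gt_of_ne hij with h | h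
  · rw [eps_erase_of_lt h hi, eps_erase_of_not_lt h.asymm]
    ring
  · rw [eps_erase_of_lt h hj, eps_erase_of_not_lt h.asymm]
    ring

theorem wedgeCoeff_erase {n p : ℕ} {j : Fin n} {J : MultiIndex n (p + 1)} (hj : j ∈ J.1)
    (h : (J.1.erase j).card = p) : wedgeCoeff j ⟨J.1.erase j, h⟩ J = eps j J.1 := by
  rw [← eps_erase_of_not_lt (lt_irrefl j), wedgeCoeff, eps, if_pos]
  exact ⟨Finset.notMem_erase _ _, (Finset.insert_erase hj).symm⟩

theorem norm_wedgeCoeff_le {n p : ℕ} (j : Fin n) (K : MultiIndex n p) (J : MultiIndex n (p + 1)) :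
    ‖wedgeCoeff j K J‖ ≤ 1 := by
  rw [wedgeCoeff]
  split_ifs <;> simp

/-- For given j only K = J ∖ {j} contributes. This replaces the double sum over multi-indices by a
sum over the elements of J. -/
theorem sum_wedgeCoeff_mul {n p : ℕ} (J : MultiIndex n (p + 1)) (g : Fin n → Finset (Fin n) → ℂ) :
    ∑ j, ∑ K : MultiIndex n p, wedgeCoeff j K J * g j K.1 =
      ∑ j ∈ J.1, eps j J.1 * g j (J.1.erase j) := by
  rw [← Finset.sum_subset (Finset.subset_univ J.1)]
  · refine Finset.sum_congr rfl fun j hj => ?_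
    have hc : (J.1.erase j).card = p := by
      rw [Finset.card_erase_of_mem hj, J.2]
      rfl
    rw [Finset.sum_eq_single ⟨J.1.erase j, hc⟩, wedgeCoeff_erase hj hc]
    · intro K _ hK
      rw [wedgeCoeff, if_neg, zero_mul]
      rintro ⟨h1, h2⟩
      refine hK (Subtype.ext ?_)
      change K.1 = J.1.erase j
      rw [h2, Finset.erase_insert h1]
    · simp
  · intro j _ hj
    refine Finset.sum_eq_zero fun K _ => ?_
    rw [wedgeCoeff, if_neg, zero_mul]
    rintro ⟨-, h2⟩
    exact hj (by simp [h2])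

/-- The form `c ∧ u` for a constant form `c = ∑ c_j dt_j`. -/
def wedge {n p : ℕ} (c : Fin n → ℂ) (u : MultiIndex n p → ℂ) (J : MultiIndex n (p + 1)) : ℂ :=
  ∑ j, ∑ K : MultiIndex n p, wedgeCoeff j K J * (c j * u K)

/-- Extension by zero of the coefficients of a form to all sets of indices. -/
def extend {n p : ℕ} (u : MultiIndex n p → ℂ) (S : Finset (Fin n)) : ℂ :=
  if h : S.card = p then u ⟨S, h⟩ else 0

@[simp]
theorem extend_coe {n p : ℕ} (u : MultiIndex n p → ℂ) (K : MultiIndex n p) :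
    extend u K.1 = u K := by
  rw [extend, dif_pos K.2]

theorem wedge_eq_sum {n p : ℕ} (c : Fin n → ℂ) (u : MultiIndex n p → ℂ)
    (J : MultiIndex n (p + 1)) :
    wedge c u J = ∑ j ∈ J.1, eps j J.1 * (c j * extend u (J.1.erase j)) := by
  rw [← sum_wedgeCoeff_mul J fun j S => c j * extend u S]
  simp only [extend_coe]
  rfl

/-- `c ∧ c ∧ u = 0`. -/
theorem wedge_wedge {n p : ℕ} (c : Fin n → ℂ) (u : MultiIndex n p → ℂ) :
    wedge c (wedge c u) = 0 := by
  funext J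
  let a : Fin n → Fin n → ℂ := fun j i =>
    eps j J.1 * eps i (J.1.erase j) * (c j * c i * extend u ((J.1.erase j).erase i))
  have h1 : wedge c (wedge c u) J = ∑ j ∈ J.1, ∑ i ∈ J.1.erase j, a j i := by
    rw [wedge_eq_sum]
    refine Finset.sum_congr rfl fun j hj => ?_
    have hc : (J.1.erase j).card = p + 1 := by
      rw [Finset.card_erase_of_mem hj, J.2]
      rfl
    have h2 := extend_coe (wedge c u) ⟨J.1.erase j, hc⟩
    change extend (wedge c u) (J.1.erase j) = _ at h2
    rw [h2, wedge_eq_sum, Finset.mul_sum, Finset.mul_sum]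
    refine Finset.sum_congr rfl fun i _ => ?_
    simp only [a]
    ring
  -- Exchanging i and j preserves the double sum, while each term is antisymmetric; the sum
  -- therefore equals its negative.
  have h2 : ∑ j ∈ J.1, ∑ i ∈ J.1.erase j, a j i = ∑ j ∈ J.1, ∑ i ∈ J.1.erase j, a i j := by
    refine Finset.sum_comm' fun x y => ?_
    simp only [Finset.mem_erase]
    tauto
  have h3 : ∑ j ∈ J.1, ∑ i ∈ J.1.erase j, a i j = -∑ j ∈ J.1, ∑ i ∈ J.1.erase j, a j i := by
    rw [← Finset.sum_neg_distrib]
    refine Finset.sum_congr rfl fun j hj => ?_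
    rw [← Finset.sum_neg_distrib]
    refine Finset.sum_congr rfl fun i hi => ?_
    obtain ⟨hij, hi⟩ := Finset.mem_erase.1 hi
    simp only [a]
    rw [eps_mul_eps_erase hij.symm hj hi, Finset.erase_right_comm]
    ring
  rw [h1]
  exact self_eq_neg.1 (h2.trans h3)

/-- The contraction of a form with the `i`-th coordinate vector. -/
def contract {n p : ℕ} (i : Fin n) (f : MultiIndex n (p + 1) → ℂ) (K : MultiIndex n p) : ℂ :=
  if i ∈ K.1 then 0 else eps i K.1 * extend f (insert i K.1)

theorem extend_contract {n p : ℕ} (i : Fin n) (f : MultiIndex n (p + 1) → ℂ) (S : Finset (Fin n))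
    (hS : S.card = p) :
    extend (contract i f) S = if i ∈ S then 0 else eps i S * extend f (insert i S) := by
  rw [extend, dif_pos hS]
  rfl

/-- If `c ∧ f = 0`, then `c ∧ ι_i f = c_i f`. -/
theorem wedge_contract {n p : ℕ} (c : Fin n → ℂ) (f : MultiIndex n (p + 1) → ℂ)
    (hf : wedge c f = 0) (i : Fin n) (J : MultiIndex n (p + 1)) :
    wedge c (contract i f) J = c i * f J := by
  have hc : ∀ j ∈ J.1, (J.1.erase j).card = p := fun j hj => by
    rw [Finset.card_erase_of_mem hj, J.2]
    rfl
  rw [wedge_eq_sum]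
  by_cases hi : i ∈ J.1
  -- The contraction has no component containing i, so removing any j ≠ i from J gives zero.
  · rw [Finset.sum_eq_single_of_mem i hi]
    · rw [extend_contract _ _ _ (hc i hi), if_neg (Finset.notMem_erase _ _),
        eps_erase_of_not_lt (lt_irrefl i), Finset.insert_erase hi, extend_coe]
      linear_combination c i * f J * eps_mul_self i J.1
    · intro j hj hji
      rw [extend_contract _ _ _ (hc j hj), if_pos (Finset.mem_erase.2 ⟨hji.symm, hi⟩)]
      simp
  -- Here the component of c ∧ f = 0 at J ∪ {i} is used: its j = i term is c_i f_J up to sign, and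
  -- the remaining terms are those of c ∧ ι_i f up to the same sign.
  · have hS : (insert i J.1).card = p + 1 + 1 := by
      rw [Finset.card_insert_of_notMem hi, J.2]
    have h := congrFun hf ⟨insert i J.1, hS⟩
    rw [wedge_eq_sum, Finset.sum_insert hi, Finset.erase_insert hi, extend_coe, Pi.zero_apply] at h
    have h2 : ∀ j ∈ J.1, eps j J.1 * (c j * extend (contract i f) (J.1.erase j)) =
        -eps i (insert i J.1) *
          (eps j (insert i J.1) * (c j * extend f ((insert i J.1).erase j))) := by
      intro j hj
      have hij : i ≠ j := fun h => hi (h ▸ hj)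
      have h3 := eps_erase_mul_eps_erase hij (Finset.mem_insert_self i J.1)
        (Finset.mem_insert_of_mem hj)
      have h4 : eps i ((insert i J.1).erase j) = eps i (J.1.erase j) := by
        rw [← eps_erase_of_not_lt (lt_irrefl i), Finset.erase_right_comm, Finset.erase_insert hi]
      rw [Finset.erase_insert hi, h4] at h3
      rw [extend_contract _ _ _ (hc j hj), if_neg fun h => hi (Finset.mem_of_mem_erase h),
        Finset.erase_insert_of_ne hij]
      linear_combination c j * extend f (insert i (J.1.erase j)) * h3
    rw [Finset.sum_congr rfl h2, ← Finset.mul_sum, eq_neg_of_add_eq_zero_right h]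
    linear_combination c i * f J * eps_mul_self i (insert i J.1)

theorem norm_contract_le {n p : ℕ} (i : Fin n) (f : MultiIndex n (p + 1) → ℂ)
    (K : MultiIndex n p) : ‖contract i f K‖ ≤ ∑ J, ‖f J‖ := by
  have h0 : 0 ≤ ∑ J, ‖f J‖ := Finset.sum_nonneg fun J _ => norm_nonneg _
  rw [contract]
  split_ifs
  · simpa using h0
  · rw [norm_mul, norm_eps, one_mul, extend]
    split_ifs
    · exact Finset.single_le_sum (f := fun J => ‖f J‖) (fun J _ => norm_nonneg _)
        (Finset.mem_univ _)
    · simpa using h0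

theorem norm_wedge_le {n p : ℕ} (c : Fin n → ℂ) (u : MultiIndex n p → ℂ) {A B : ℝ} (hA : 0 ≤ A)
    (hc : ∀ j, ‖c j‖ ≤ A) (hu : ∀ K, ‖u K‖ ≤ B) (J : MultiIndex n (p + 1)) :
    ‖wedge c u J‖ ≤ n * Fintype.card (MultiIndex n p) * (A * B) := by
  have h : ∀ j K, ‖wedgeCoeff j K J * (c j * u K)‖ ≤ A * B := fun j K => by
    rw [norm_mul, norm_mul]
    refine (mul_le_of_le_one_left (by positivity) (norm_wedgeCoeff_le j K J)).trans ?_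
    exact mul_le_mul (hc j) (hu K) (norm_nonneg _) hA
  refine (norm_sum_le _ _).trans ((Finset.sum_le_sum fun j _ => (norm_sum_le _ _).trans
    (Finset.sum_le_sum fun K _ => h j K)).trans (le_of_eq ?_))
  simp
  ring

/-- The single component of `c ∧ (b dt_K)` in the direction `dt_i ∧ dt_K`. -/
theorem norm_wedge_single {n p : ℕ} (c : Fin n → ℂ) (K : MultiIndex n p) {i : Fin n}
    (hi : i ∉ K.1) (b : ℂ) (h : (insert i K.1).card = p + 1) :
    ‖wedge c (Pi.single K b) ⟨insert i K.1, h⟩‖ = ‖c i‖ * ‖b‖ := by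
  rw [wedge_eq_sum, Finset.sum_eq_single_of_mem i (Finset.mem_insert_self _ _)]
  · rw [Finset.erase_insert hi, extend_coe]
    simp [norm_eps]
  · intro j hj hji
    have hc : extend (Pi.single K b : MultiIndex n p → ℂ) ((insert i K.1).erase j) = 0 := by
      rw [extend]
      split_ifs with h1
      · refine Pi.single_eq_of_ne (fun h2 => ?_) _
        have h3 : i ∈ (insert i K.1).erase j :=
          Finset.mem_erase.2 ⟨hji.symm, Finset.mem_insert_self _ _⟩
        have h4 : (insert i K.1).erase j = K.1 := congrArg Subtype.val h2
        exact hi (h4 ▸ h3)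
      · rfl
    rw [hc]
    simp

/-! ### The symbol and its Diophantine lower bound. -/

/-- The components `η_j + a_j ξ` of the symbol of `𝕃 / i` at the frequency `k = (η, ξ)`. -/
def symbol {n : ℕ} (a : Fin n → ℝ) (k : Coord n → ℤ) (j : Fin n) : ℝ :=
  (k (Sum.inl j) : ℝ) + a j * (k (Sum.inr 0) : ℝ)

/-- The loop around the j-th coordinate circle has period c_j; conversely, the integral along any
curve depends only on its endpoints, by the fundamental theorem of calculus. -/
theorem isIntegralForm_iff {n : ℕ} (c : Fin n → ℝ) :
    IsIntegralForm c ↔ ∀ j, ∃ m : ℤ, c j = m := by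
  have h2π : (2 * Real.pi) ≠ 0 := by positivity
  constructor
  · intro h j
    let v : Fin n → ℝ := Pi.single j (2 * Real.pi)
    have hd : ∀ s : ℝ, HasDerivAt (fun s : ℝ => s • v) v s := fun s => by
      simpa using (hasDerivAt_id s).smul_const v
    obtain ⟨m, hm⟩ := h (fun s => s • v) (contDiff_id.smul contDiff_const) fun i => by
      by_cases hi : i = j
      · subst hi
        exact ⟨1, by simp [v]⟩
      · exact ⟨0, by simp [v, hi]⟩
    refine ⟨m, ?_⟩
    rw [← hm]
    simp only [(hd _).deriv]
    simp [v, Pi.single_apply]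
    field_simp
  · intro h γ hγ hm
    choose m hm using hm
    choose e he using h
    refine ⟨∑ j, e j * m j, ?_⟩
    have hd : ∀ s j, HasDerivAt (fun s => γ s j) (deriv γ s j) s := fun s =>
      hasDerivAt_pi.1 (hγ.differentiable one_ne_zero s).hasDerivAt
    have hc : Continuous (deriv γ) := hγ.continuous_deriv le_rfl
    have h1 := intervalIntegral.integral_eq_sub_of_hasDerivAt (a := 0) (b := 1)
      (f := fun s => ∑ j, c j * γ s j) (f' := fun s => ∑ j, c j * deriv γ s j)
      (fun s _ => HasDerivAt.fun_sum fun j _ => (hd s j).const_mul _)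
      (by
        refine Continuous.intervalIntegrable ?_ _ _
        exact continuous_finsetSum _ fun j _ =>
          continuous_const.mul ((continuous_apply j).comp hc))
    rw [h1, ← Finset.sum_sub_distrib]
    simp only [← mul_sub, hm, he]
    push_cast
    rw [Finset.mul_sum]
    refine Finset.sum_congr rfl fun j _ => ?_
    field_simp

theorem isRationalForm_of_isIntegralForm {n : ℕ} {a : Fin n → ℝ} {ξ : ℤ} (hξ : ξ ≠ 0)
    (h : IsIntegralForm fun j => (ξ : ℝ) * a j) : IsRationalForm a := by
  rw [isIntegralForm_iff] at h
  refine ⟨ξ.natAbs, Int.natAbs_pos.2 hξ, (isIntegralForm_iff _).2 fun j => ?_⟩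
  obtain ⟨m, hm⟩ := h j
  have h1 : ((ξ.natAbs : ℕ) : ℝ) = |(ξ : ℝ)| := by rw [Nat.cast_natAbs, Int.cast_abs]
  rw [h1]
  rcases abs_choice (ξ : ℝ) with h2 | h2
  · exact ⟨m, by rw [h2, hm]⟩
  · exact ⟨-m, by rw [h2, neg_mul, hm]; simp⟩

theorem isIntegralForm_of_symbol_eq_zero {n : ℕ} {a : Fin n → ℝ} {k : Coord n → ℤ}
    (h : ∀ j, symbol a k j = 0) : IsIntegralForm fun j => (k (Sum.inr 0) : ℝ) * a j :=
  (isIntegralForm_iff _).2 fun j => ⟨-k (Sum.inl j), by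
    have := h j
    rw [symbol] at this
    push_cast
    linarith⟩

theorem one_le_norm_of_ne_zero {ι : Type} [Fintype ι] {k : ι → ℤ} (hk : k ≠ 0) : 1 ≤ ‖k‖ := by
  obtain ⟨i, hi⟩ := Function.ne_iff.1 hk
  refine le_trans ?_ (norm_le_pi_norm k i)
  rw [Int.norm_eq_abs]
  exact_mod_cast Int.one_le_abs hi

theorem one_le_norm_of_symbol_ne_zero {n : ℕ} {a : Fin n → ℝ} {k : Coord n → ℤ} {j : Fin n}
    (h : symbol a k j ≠ 0) : 1 ≤ ‖k‖ :=
  one_le_norm_of_ne_zero fun hk => h (by simp [symbol, hk])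

/-- Comparison of the Euclidean norm of a frequency with its sup norm. -/
theorem sqrt_sum_sq_le {n : ℕ} (k : Coord n → ℤ) :
    Real.sqrt ((∑ i, (k (Sum.inl i) : ℝ) ^ 2) + (k (Sum.inr 0) : ℝ) ^ 2) ≤ (n + 1) * ‖k‖ := by
  refine Real.sqrt_le_iff.2 ⟨by positivity, ?_⟩
  have h : ∀ i, (k i : ℝ) ^ 2 ≤ ‖k‖ ^ 2 := fun i => by
    have h1 := norm_le_pi_norm k i
    rw [Int.norm_eq_abs] at h1
    rw [← sq_abs]
    exact pow_le_pow_left₀ (abs_nonneg _) h1 2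
  have h1 := Finset.sum_le_sum fun (i : Fin n) (_ : i ∈ Finset.univ) => h (Sum.inl i)
  rw [Finset.sum_const, Finset.card_univ, Fintype.card_fin, nsmul_eq_mul] at h1
  have h2 := h (Sum.inr 0)
  have h3 : (0 : ℝ) ≤ n * (n + 1) * ‖k‖ ^ 2 := by positivity
  nlinarith

theorem norm_le_sqrt_sum_sq {n : ℕ} (k : Coord n → ℤ) :
    ‖k‖ ≤ Real.sqrt ((∑ i, (k (Sum.inl i) : ℝ) ^ 2) + (k (Sum.inr 0) : ℝ) ^ 2) := by
  refine (pi_norm_le_iff_of_nonneg (Real.sqrt_nonneg _)).2 fun i => ?_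
  rw [Int.norm_eq_abs]
  refine Real.abs_le_sqrt ?_
  have h0 : 0 ≤ ∑ i, (k (Sum.inl i) : ℝ) ^ 2 := Finset.sum_nonneg fun i _ => sq_nonneg _
  rcases i with i | i
  · have h1 := Finset.single_le_sum (f := fun i => (k (Sum.inl i) : ℝ) ^ 2)
      (fun i _ => sq_nonneg _) (Finset.mem_univ i)
    have h2 := sq_nonneg (k (Sum.inr 0) : ℝ)
    linarith
  · rw [Subsingleton.elim i 0]
    linarith

/-- Polynomial lower bound for the symbol away from its zeros. -/
theorem exists_symbol_lower_bound {n : ℕ} {a : Fin n → ℝ}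
    (h : IsRationalForm a ∨ ¬ IsLiouvilleForm a) :
    ∃ (c : ℝ) (N : ℕ), 0 < c ∧ ∀ k : Coord n → ℤ, (∃ j, symbol a k j ≠ 0) →
      ∃ j, symbol a k j ≠ 0 ∧ c ≤ |symbol a k j| * ‖k‖ ^ N := by
  by_cases hr : IsRationalForm a
  · obtain ⟨q, hq, hqa⟩ := hr
    rw [isIntegralForm_iff] at hqa
    choose m hm using hqa
    have hq' : (0 : ℝ) < q := by exact_mod_cast hq
    -- With qa integral, q times the symbol is an integer vector, so any nonzero component is at
    -- least 1/q and no power of ‖k‖ is needed.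
    refine ⟨(q : ℝ)⁻¹, 0, by positivity, fun k ⟨j, hj⟩ => ⟨j, hj, ?_⟩⟩
    have h1 : symbol a k j = (q : ℝ)⁻¹ * ((q * k (Sum.inl j) + m j * k (Sum.inr 0) : ℤ) : ℝ) := by
      push_cast
      rw [← hm, symbol]
      field_simp
    have h2 : (q * k (Sum.inl j) + m j * k (Sum.inr 0) : ℤ) ≠ 0 := fun h0 => hj (by
      rw [h1, h0]
      simp)
    rw [pow_zero, mul_one, h1, abs_mul, abs_of_nonneg (inv_nonneg.2 hq'.le)]
    refine le_mul_of_one_le_right (by positivity) ?_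
    exact_mod_cast Int.one_le_abs h2
  -- If every exponent l failed, the failures would form a Liouville sequence with C = 1.
  · have hL : ∃ l : ℕ, ∀ (η : Fin n → ℤ) (ξ : ℤ), 2 ≤ |ξ| → ∃ j,
        (Real.sqrt ((∑ i, (η i : ℝ) ^ 2) + (ξ : ℝ) ^ 2) ^ l)⁻¹ < |(η j : ℝ) + a j * (ξ : ℝ)| := by
      by_contra! hc
      choose η ξ h1 h2 using hc
      refine (h.resolve_left hr) ⟨hr, 1, η, ξ, one_pos, h1, fun l j => ?_⟩
      rw [one_mul]
      exact h2 l j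
    obtain ⟨l, hl⟩ := hL
    have hD : (1 : ℝ) ≤ (2 * (n + 1)) ^ l := one_le_pow₀ (by
      have : (0 : ℝ) ≤ n := by positivity
      linarith)
    refine ⟨(2 * (2 * (n + 1)) ^ l)⁻¹, l, by positivity, fun k ⟨j, hj⟩ => ?_⟩
    have hk := one_le_norm_of_symbol_ne_zero hj
    have hkl : 1 ≤ ‖k‖ ^ l := one_le_pow₀ hk
    -- For ξ = 0 the symbol is the integer vector η itself.
    by_cases hξ : k (Sum.inr 0) = 0
    · refine ⟨j, hj, ?_⟩
      have h1 : symbol a k j = k (Sum.inl j) := by simp [symbol, hξ]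
      have h2 : 1 ≤ |symbol a k j| := by
        rw [h1] at hj ⊢
        exact_mod_cast Int.one_le_abs (by exact_mod_cast hj)
      refine (inv_le_one_of_one_le₀ (by linarith)).trans ?_
      exact one_le_mul_of_one_le_of_one_le h2 hkl
    -- The estimate only covers |ξ| ≥ 2, so it is applied to 2k in order to include ξ = ±1; doubling
    -- the frequency doubles the symbol.
    · obtain ⟨i, hi⟩ := hl (fun j => (2 • k) (Sum.inl j)) ((2 • k) (Sum.inr 0)) (by
        have := Int.one_le_abs hξ
        simp only [Pi.smul_apply, nsmul_eq_mul, abs_mul]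
        norm_num
        linarith)
      have h1 : (((2 • k) (Sum.inl i) : ℤ) : ℝ) + a i * (((2 • k) (Sum.inr 0) : ℤ) : ℝ) =
          2 * symbol a k i := by
        simp [symbol]
        ring
      rw [h1, abs_mul, abs_two] at hi
      have h2 := sqrt_sum_sq_le (2 • k)
      have hpos : 0 < Real.sqrt ((∑ i, (((2 • k) (Sum.inl i) : ℤ) : ℝ) ^ 2) +
          (((2 • k) (Sum.inr 0) : ℤ) : ℝ) ^ 2) := by
        refine lt_of_lt_of_le ?_ (norm_le_sqrt_sum_sq (2 • k))
        refine norm_pos_iff.2 fun h0 => hξ ?_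
        have := congrFun h0 (Sum.inr 0)
        simpa using this
      have h3 : ‖2 • k‖ ≤ 2 * ‖k‖ := by
        rw [two_smul, two_mul]
        exact norm_add_le _ _
      have h4 : Real.sqrt ((∑ i, (((2 • k) (Sum.inl i) : ℤ) : ℝ) ^ 2) +
          (((2 • k) (Sum.inr 0) : ℤ) : ℝ) ^ 2) ^ l ≤ (2 * (n + 1)) ^ l * ‖k‖ ^ l := by
        rw [← mul_pow]
        refine pow_le_pow_left₀ hpos.le (h2.trans ?_) l
        have : (0 : ℝ) ≤ n + 1 := by positivity
        nlinarith
      have h5 : ((2 * (n + 1)) ^ l * ‖k‖ ^ l)⁻¹ < 2 * |symbol a k i| :=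
        (inv_anti₀ (pow_pos hpos l) h4).trans_lt hi
      refine ⟨i, fun h0 => ?_, ?_⟩
      · rw [h0, abs_zero, mul_zero] at h5
        exact absurd h5 (not_lt.2 (by positivity))
      · rw [inv_lt_iff_one_lt_mul₀ (by positivity)] at h5
        rw [inv_le_iff_one_le_mul₀ (by positivity)]
        linarith

/-! ### The operators on the Fourier side. -/

theorem map_wedgeOp {n p : ℕ} {M : Type} [AddCommGroup M] [Module ℂ M] (T : M →ₗ[ℂ] ℂ)
    (X : Fin n → M →ₗ[ℂ] M) (u : MultiIndex n p → M) (J : MultiIndex n (p + 1)) :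
    T (wedgeOp X p u J) = ∑ j, ∑ K : MultiIndex n p, wedgeCoeff j K J * T (X j (u K)) := by
  simp [wedgeOp, map_sum]

/-- The operators `𝕃^p` on smooth forms and on currents, with the coefficients acted on by the
partial derivatives `D`, followed by a functional `T`. -/
theorem map_wedgeOp_add_wedgeOp {n p : ℕ} {M : Type} [AddCommGroup M] [Module ℂ M]
    (a : Fin n → ℝ) (T : M →ₗ[ℂ] ℂ) (D : Coord n → M →ₗ[ℂ] M) (u : MultiIndex n p → M)
    (J : MultiIndex n (p + 1)) :
    T ((wedgeOp (fun j => D (Sum.inl j)) p u +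
      wedgeOp (fun j => (a j : ℂ) • D (Sum.inr 0)) p u) J) =
      ∑ j, ∑ K : MultiIndex n p, wedgeCoeff j K J *
        (T (D (Sum.inl j) (u K)) + (a j : ℂ) * T (D (Sum.inr 0) (u K))) := by
  rw [Pi.add_apply, map_add, map_wedgeOp, map_wedgeOp, ← Finset.sum_add_distrib]
  refine Finset.sum_congr rfl fun j _ => ?_
  rw [← Finset.sum_add_distrib]
  refine Finset.sum_congr rfl fun K _ => ?_
  rw [LinearMap.smul_apply, map_smul, smul_eq_mul, mul_add]

theorem sum_wedgeCoeff_symbol {n p : ℕ} (a : Fin n → ℝ) (k : Coord n → ℤ)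
    (u : MultiIndex n p → ℂ) (J : MultiIndex n (p + 1)) :
    ∑ j, ∑ K : MultiIndex n p, wedgeCoeff j K J *
        (Complex.I * (k (Sum.inl j) : ℂ) * u K +
          (a j : ℂ) * (Complex.I * (k (Sum.inr 0) : ℂ) * u K)) =
      Complex.I * wedge (fun j => (symbol a k j : ℂ)) u J := by
  rw [wedge, Finset.mul_sum]
  refine Finset.sum_congr rfl fun j _ => ?_
  rw [Finset.mul_sum]
  refine Finset.sum_congr rfl fun K _ => ?_
  simp only [symbol]
  push_cast
  ring

theorem coeff_smoothL {n p : ℕ} (a : Fin n → ℝ) (f : MultiIndex n p → Smooth (Coord n))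
    (k : Coord n → ℤ) (J : MultiIndex n (p + 1)) :
    coeff k (smoothL a p f J) =
      Complex.I * wedge (fun j => (symbol a k j : ℂ)) (fun K => coeff k (f K)) J := by
  rw [smoothL, map_wedgeOp_add_wedgeOp a (coeff k) Smooth.pderiv]
  simp only [coeff_pderiv]
  exact sum_wedgeCoeff_symbol a k _ J

/-- Evaluation of distributions at a test function. -/
def Distribution.eval {ι : Type} [Fintype ι] (φ : Smooth ι) : Distribution ι →ₗ[ℂ] ℂ :=
  LinearMap.applyₗ φ ∘ₗ (Distribution ι).subtype

theorem Distribution.eval_apply {ι : Type} [Fintype ι] (φ : Smooth ι) (u : Distribution ι) :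
    Distribution.eval φ u = (u : Smooth ι →ₗ[ℂ] ℂ) φ :=
  rfl

theorem Distribution.eval_pderiv {ι : Type} [Fintype ι] [DecidableEq ι] (i : ι) (φ : Smooth ι)
    (u : Distribution ι) :
    Distribution.eval φ (Distribution.pderiv i u) = -Distribution.eval (Smooth.pderiv i φ) u :=
  rfl

theorem norm_mul_pairing_chi_le {ι : Type} [Fintype ι] (w : (ι → ℤ) → ℂ) {φ : Smooth ι} {M : ℝ}
    (hM : ∀ x, ‖(φ : (ι → ℝ) → ℂ) x‖ ≤ M) (k : ι → ℤ) :
    ‖w k * pairing (chi k) φ‖ ≤ ‖w k‖ * (M * (2 * Real.pi) ^ Fintype.card ι) := by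
  rw [norm_mul]
  refine mul_le_mul_of_nonneg_left ?_ (norm_nonneg _)
  simpa using norm_pairing_le φ (chi k) hM fun x => (norm_chi k x).le

/-- The distribution with given summable Fourier coefficients. -/
def Distribution.ofCoeff {ι : Type} [Fintype ι] (w : (ι → ℤ) → ℂ)
    (hw : Summable fun k => ‖w k‖) : Distribution ι :=
  have hs : ∀ φ : Smooth ι, Summable fun k => w k * pairing (chi k) φ := fun φ => by
    obtain ⟨M, hM⟩ := Smooth.exists_norm_le φ
    exact Summable.of_norm_bounded (hw.mul_right _) (norm_mul_pairing_chi_le w hM)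
  ⟨{ toFun := fun φ => ∑' k, w k * pairing (chi k) φ
     map_add' := fun φ ψ => by
      rw [← (hs φ).tsum_add (hs ψ)]
      simp only [map_add, mul_add]
     map_smul' := fun c φ => by
      rw [RingHom.id_apply, smul_eq_mul, ← tsum_mul_left]
      simp only [map_smul, smul_eq_mul, mul_left_comm] },
    0, (∑' k, ‖w k‖) * (2 * Real.pi) ^ Fintype.card ι, fun φ M hM => by
      have hM' : ∀ x, ‖(φ : (ι → ℝ) → ℂ) x‖ ≤ M := fun x => by
        simpa using hM 0 le_rfl x
      have h := tsum_of_norm_bounded ((hw.mul_right _).hasSum) (norm_mul_pairing_chi_le w hM')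
      rw [tsum_mul_right] at h
      refine h.trans (le_of_eq ?_)
      ring⟩

theorem Distribution.hasSum_ofCoeff {ι : Type} [Fintype ι] {w : (ι → ℤ) → ℂ}
    (hw : Summable fun k => ‖w k‖) (φ : Smooth ι) :
    HasSum (fun k => w k * pairing φ (chi k)) (Distribution.eval φ (Distribution.ofCoeff w hw)) := by
  obtain ⟨M, hM⟩ := Smooth.exists_norm_le φ
  simp only [pairing_comm _ φ]
  exact (Summable.of_norm_bounded (hw.mul_right _) (norm_mul_pairing_chi_le w hM)).hasSum

theorem Distribution.hasSum_pderiv_ofCoeff {ι : Type} [Fintype ι] [DecidableEq ι]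
    {w : (ι → ℤ) → ℂ} (hw : Summable fun k => ‖w k‖) (φ : Smooth ι) (i : ι) :
    HasSum (fun k => Complex.I * (k i : ℂ) * w k * pairing φ (chi k))
      (Distribution.eval φ (Distribution.pderiv i (Distribution.ofCoeff w hw))) := by
  rw [Distribution.eval_pderiv]
  refine (Distribution.hasSum_ofCoeff hw (Smooth.pderiv i φ)).neg.congr_fun fun k => ?_
  have h := pairing_pderiv i (chi k) φ
  rw [pderiv_chi, map_smul, smul_eq_mul] at h
  linear_combination w k * h

theorem hasSum_currentL_ofCoeff {n p : ℕ} (a : Fin n → ℝ)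
    {w : MultiIndex n p → (Coord n → ℤ) → ℂ} (hw : ∀ K, Summable fun k => ‖w K k‖)
    (φ : Smooth (Coord n)) (J : MultiIndex n (p + 1)) :
    HasSum (fun k => Complex.I * wedge (fun j => (symbol a k j : ℂ)) (fun K => w K k) J *
        pairing φ (chi k))
      (Distribution.eval φ (currentL a p (fun K => Distribution.ofCoeff (w K) (hw K)) J)) := by
  rw [currentL, map_wedgeOp_add_wedgeOp a (Distribution.eval φ) Distribution.pderiv]
  refine (hasSum_sum fun j _ => hasSum_sum fun K _ =>
    ((Distribution.hasSum_pderiv_ofCoeff (hw K) φ (Sum.inl j)).add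
      ((Distribution.hasSum_pderiv_ofCoeff (hw K) φ (Sum.inr 0)).mul_left (a j : ℂ))).mul_left
        (wedgeCoeff j K J)).congr_fun fun k => ?_
  rw [← sum_wedgeCoeff_symbol, Finset.sum_mul]
  refine Finset.sum_congr rfl fun j _ => ?_
  rw [Finset.sum_mul]
  refine Finset.sum_congr rfl fun K _ => ?_
  ring

/-! ### Compatibility conditions and sufficiency. -/

/-- Fubini's theorem on `𝕋^n × 𝕋^1`. -/
theorem setIntegral_box_coord {n : ℕ} {F : (Coord n → ℝ) → ℂ} (hF : Continuous F) :
    ∫ y in box (Coord n), F y =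
      ∫ t in box (Fin n), ∫ x in (0 : ℝ)..(2 * Real.pi), F (Sum.elim t fun _ => x) := by
  let e := (MeasurableEquiv.sumPiEquivProdPi fun _ : Coord n => ℝ).symm
  have he : ∀ z, e z = Sum.elim z.1 z.2 := fun z => by
    funext i
    rcases i with i | i <;> rfl
  have hpre : e ⁻¹' box (Coord n) = box (Fin n) ×ˢ box (Fin 1) := by
    ext z
    simp only [box, Set.mem_preimage, he, Set.mem_prod, Set.mem_Icc, Pi.le_def, Sum.forall,
      Sum.elim_inl, Sum.elim_inr, Pi.zero_apply]
    tauto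
  have hc : Continuous fun z : (Fin n → ℝ) × (Fin 1 → ℝ) => F (Sum.elim z.1 z.2) := by
    refine hF.comp (continuous_pi fun i => ?_)
    rcases i with i | i
    · exact (continuous_apply i).comp continuous_fst
    · exact (continuous_apply i).comp continuous_snd
  rw [← (volume_measurePreserving_sumPiEquivProdPi_symm fun _ : Coord n => ℝ).setIntegral_preimage_emb
    (MeasurableEquiv.measurableEmbedding _)]
  change ∫ z in e ⁻¹' box (Coord n), F (e z) = _
  rw [hpre]
  simp only [he]
  rw [Measure.volume_eq_prod, setIntegral_prod _
    (hc.continuousOn.integrableOn_compact ((isCompact_box _).prod (isCompact_box _)))]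
  refine integral_congr_ae (.of_forall fun t => ?_)
  change ∫ y in box (Fin 1), F (Sum.elim t y) =
    ∫ x in (0 : ℝ)..(2 * Real.pi), F (Sum.elim t fun _ => x)
  have H : ((MeasurableEquiv.funUnique (Fin 1) ℝ).symm) ⁻¹' box (Fin 1) =
      Set.Icc 0 (2 * Real.pi) :=
    (OrderIso.funUnique (Fin 1) ℝ).symm.preimage_Icc _ _
  have h := ((volume_preserving_funUnique (Fin 1) ℝ).symm _).setIntegral_preimage_emb
    (MeasurableEquiv.measurableEmbedding _) (fun y => F (Sum.elim t y)) (box (Fin 1))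
  rw [H] at h
  rw [intervalIntegral.integral_of_le Real.two_pi_pos.le, Measure.restrict_congr_set Ioc_ae_eq_Icc]
  exact h.symm

/-- An exact form has mean zero. -/
theorem IsExactForm.setIntegral_box_eq_zero {n p : ℕ}
    {g : MultiIndex n (p + 1) → (Fin n → ℝ) → ℂ} (hg : IsExactForm g) (J : MultiIndex n (p + 1)) :
    ∫ t in box (Fin n), g J t = 0 := by
  obtain ⟨v, hv⟩ := hg
  have h := map_wedgeOp (coeff (0 : Fin n → ℤ)) (fun j => Smooth.pderiv j) v J
  simp only [coeff_pderiv, Pi.zero_apply, Int.cast_zero, mul_zero, zero_mul,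
    Finset.sum_const_zero] at h
  have h1 := pairing_chi_neg (0 : Fin n → ℤ) (wedgeOp (fun j => Smooth.pderiv j) p v J)
  rw [h, mul_zero, pairing_apply, hv] at h1
  simpa [chi_apply, freq_apply] using h1

/-- The compatibility conditions at the zeros of the symbol. -/
theorem coeff_eq_zero_of_compatible {n p : ℕ} {a : Fin n → ℝ}
    {f : MultiIndex n (p + 1) → Smooth (Coord n)} (hf : f ∈ compatible a p) {k : Coord n → ℤ}
    (hk : ∀ j, symbol a k j = 0) (J : MultiIndex n (p + 1)) : coeff k (f J) = 0 := by
  let L : (Fin n → ℝ) →L[ℝ] ℝ := ∑ j, ((k (Sum.inr 0) : ℝ) * a j) •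
    (ContinuousLinearMap.proj j : (Fin n → ℝ) →L[ℝ] ℝ)
  have h := (hf.2 (k (Sum.inr 0)) (isIntegralForm_of_symbol_eq_zero hk) L
    fun t => L.hasFDerivAt).setIntegral_box_eq_zero J
  -- At a zero of the symbol ξa = -η, so the primitive is -η·t, and e^{iL} completes e^{-iξx} to the
  -- character of frequency -k.
  have hL : ∀ t, L t = -∑ j, (k (Sum.inl j) : ℝ) * t j := fun t => by
    simp only [L, sum_apply, smul_apply,
      ContinuousLinearMap.proj_apply, smul_eq_mul]
    rw [← Finset.sum_neg_distrib]
    refine Finset.sum_congr rfl fun j _ => ?_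
    have := hk j
    rw [symbol] at this
    linear_combination t j * this
  have hchi : ∀ t x, (chi (-k) : (Coord n → ℝ) → ℂ) (Sum.elim t fun _ => x) =
      Complex.exp (-Complex.I * (k (Sum.inr 0) : ℂ) * (x : ℂ)) * Complex.exp (Complex.I * (L t : ℂ)) :=
    fun t x => by
      rw [chi_apply, ← Complex.exp_add, hL, freq_apply]
      congr 1
      simp
      ring
  have h1 := setIntegral_box_coord
    (F := fun y => (f J : (Coord n → ℝ) → ℂ) y * (chi (-k) : (Coord n → ℝ) → ℂ) y)
    ((Smooth.continuous (f J)).mul (Smooth.continuous (chi (-k))))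
  have h2 : pairing (chi (-k)) (f J) = 0 := by
    rw [pairing_apply]
    refine h1.trans ?_
    have h3 : ∀ t, ∫ x in (0 : ℝ)..(2 * Real.pi), (f J : (Coord n → ℝ) → ℂ) (Sum.elim t fun _ => x) *
        (chi (-k) : (Coord n → ℝ) → ℂ) (Sum.elim t fun _ => x) =
        2 * (Real.pi : ℂ) * (partialFourier (f J) (k (Sum.inr 0)) t *
          Complex.exp (Complex.I * (L t : ℂ))) := fun t => by
      simp only [hchi, ← mul_assoc]
      rw [intervalIntegral.integral_mul_const, partialFourier]
      have : (Real.pi : ℂ) ≠ 0 := by exact_mod_cast Real.pi_ne_zero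
      field_simp
    simp only [h3]
    rw [integral_const_mul, h, mul_zero]
  rw [coeff, LinearMap.smul_apply, h2, smul_zero]

theorem wedge_const_mul {n p : ℕ} (c : Fin n → ℂ) (b : ℂ) (u : MultiIndex n p → ℂ)
    (J : MultiIndex n (p + 1)) : wedge c (fun K => b * u K) J = b * wedge c u J := by
  rw [wedge, wedge, Finset.mul_sum]
  refine Finset.sum_congr rfl fun j _ => ?_
  rw [Finset.mul_sum]
  refine Finset.sum_congr rfl fun K _ => ?_
  ring

/-- The solution is built frequency by frequency. The bound required alongside each algebraic
solution makes the chosen coefficients summable. -/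
theorem globallySolvable_of_rational_or_not_liouville {n : ℕ} (p : ℕ) {a : Fin n → ℝ}
    (h : IsRationalForm a ∨ ¬ IsLiouvilleForm a) : GloballySolvable a p := by
  classical
  obtain ⟨c, N, hc, hN⟩ := exists_symbol_lower_bound h
  intro f hf
  have hex : ∀ k : Coord n → ℤ, ∃ u : MultiIndex n p → ℂ,
      (∀ J, Complex.I * wedge (fun j => (symbol a k j : ℂ)) u J = coeff k (f J)) ∧
      ∀ K, ‖u K‖ ≤ c⁻¹ * ∑ J, ‖k‖ ^ N * ‖coeff k (f J)‖ := by
    intro k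
    by_cases hk : ∃ j, symbol a k j ≠ 0
    · obtain ⟨i, hi, hle⟩ := hN k hk
      have hi' : (symbol a k i : ℂ) ≠ 0 := by exact_mod_cast hi
      have hw : wedge (fun j => (symbol a k j : ℂ)) (fun J => coeff k (f J)) = 0 := by
        funext J
        have h1 := coeff_smoothL a f k J
        rw [hf.1] at h1
        exact (mul_eq_zero.1 (h1.symm.trans (map_zero _))).resolve_left Complex.I_ne_zero
      -- Contraction with the i-th vector inverts the wedge product up to the factor σ_i; i is the
      -- index supplied by the lower bound.
      refine ⟨fun K => (Complex.I * (symbol a k i : ℂ))⁻¹ * contract i (fun J => coeff k (f J)) K,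
        fun J => ?_, fun K => ?_⟩
      · rw [wedge_const_mul, wedge_contract _ _ hw]
        field_simp [Complex.I_ne_zero]
      · rw [norm_mul, norm_inv, norm_mul, Complex.norm_I, one_mul, Complex.norm_real,
          Real.norm_eq_abs, ← Finset.mul_sum, ← mul_assoc]
        refine mul_le_mul ?_ (norm_contract_le _ _ _) (norm_nonneg _) (by positivity)
        have hi'' : 0 < |symbol a k i| := abs_pos.2 hi
        rw [inv_le_iff_one_le_mul₀ hi'', mul_assoc, le_inv_mul_iff₀ hc, mul_one]
        linarith
    · push Not at hk
      refine ⟨0, fun J => ?_, fun K => ?_⟩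
      · rw [coeff_eq_zero_of_compatible hf hk J]
        simp [wedge]
      · rw [Pi.zero_apply, norm_zero]
        positivity
  choose u hu hu' using hex
  have hs : ∀ K, Summable fun k => ‖u k K‖ := fun K =>
    Summable.of_nonneg_of_le (fun k => norm_nonneg _) (fun k => hu' k K)
      ((summable_sum fun J _ => summable_norm_pow_mul_norm_coeff (f J) N).mul_left _)
  refine ⟨fun K => Distribution.ofCoeff (fun k => u k K) (hs K), fun J φ => ?_⟩
  have h1 := hasSum_currentL_ofCoeff a hs φ J
  simp only [hu] at h1
  exact h1.unique (hasSum_pairing (summable_norm_coeff (f J)) (hasSum_coeff_mul_chi (f J)) φ)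

/-! ### Necessity: a Liouville form obstructs solvability. -/

/-- The mean in `x` vanishes if the Fourier coefficients with `ξ = 0` do. -/
theorem partialFourier_zero_eq_zero {n : ℕ} {f : Smooth (Coord n)}
    (hf : ∀ k : Coord n → ℤ, k (Sum.inr 0) = 0 → coeff k f = 0) (t : Fin n → ℝ) :
    partialFourier f 0 t = 0 := by
  have hchi : ∀ (k : Coord n → ℤ) (x : ℝ), (chi k : (Coord n → ℝ) → ℂ) (Sum.elim t fun _ => x) =
      Complex.exp (Complex.I * ((∑ j, (k (Sum.inl j) : ℝ) * t j : ℝ) : ℂ)) *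
        Complex.exp (Complex.I * (k (Sum.inr 0) : ℂ) * x) := fun k x => by
    rw [chi_apply, ← Complex.exp_add, freq_apply]
    congr 1
    simp
    ring
  have h0 : ∀ k : Coord n → ℤ, ∫ x in (0 : ℝ)..(2 * Real.pi),
      coeff k f * (chi k : (Coord n → ℝ) → ℂ) (Sum.elim t fun _ => x) = 0 := fun k => by
    by_cases hk : k (Sum.inr 0) = 0
    · simp [hf k hk]
    · have hc : Complex.I * (k (Sum.inr 0) : ℂ) ≠ 0 :=
        mul_ne_zero Complex.I_ne_zero (by exact_mod_cast hk)
      simp only [hchi]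
      rw [intervalIntegral.integral_const_mul, intervalIntegral.integral_const_mul,
        integral_exp_mul_complex hc]
      have h1 : Complex.exp (Complex.I * (k (Sum.inr 0) : ℂ) * ((2 * Real.pi : ℝ) : ℂ)) = 1 := by
        rw [Complex.exp_eq_one_iff]
        refine ⟨k (Sum.inr 0), ?_⟩
        push_cast
        ring
      rw [h1]
      simp
  have hcont : ∀ k : Coord n → ℤ, Continuous fun x : ℝ =>
      coeff k f * (chi k : (Coord n → ℝ) → ℂ) (Sum.elim t fun _ => x) := fun k => by
    simp only [hchi]
    fun_prop
  have h := intervalIntegral.hasSum_integral_of_dominated_convergence (μ := volume)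
    (a := 0) (b := 2 * Real.pi) (bound := fun k _ => ‖coeff k f‖)
    (F := fun (k : Coord n → ℤ) (x : ℝ) =>
      coeff k f * (chi k : (Coord n → ℝ) → ℂ) (Sum.elim t fun _ => x))
    (f := fun x => (f : (Coord n → ℝ) → ℂ) (Sum.elim t fun _ => x))
    (fun k => (hcont k).aestronglyMeasurable)
    (fun k => .of_forall fun x _ => by rw [norm_mul, norm_chi, mul_one])
    (.of_forall fun x _ => summable_norm_coeff f)
    intervalIntegrable_const
    (.of_forall fun x _ => hasSum_coeff_mul_chi f _)
  simp only [h0] at h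
  rw [partialFourier]
  simp [h.unique hasSum_zero]

/-- The Fourier coefficients of a distribution grow at most polynomially. -/
theorem Distribution.exists_norm_chi_le {ι : Type} [Fintype ι] (u : Distribution ι) :
    ∃ (A : ℝ) (m : ℕ), 0 ≤ A ∧ ∀ k : ι → ℤ, 1 ≤ ‖k‖ →
      ‖(u : Smooth ι →ₗ[ℂ] ℂ) (chi k)‖ ≤ A * ‖k‖ ^ m := by
  obtain ⟨m, C, hC⟩ := u.2
  refine ⟨|C| * (Fintype.card ι + 1) ^ m, m, by positivity, fun k hk => ?_⟩
  have hD : (0 : ℝ) ≤ Fintype.card ι := by positivity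
  refine (hC (chi k) (((Fintype.card ι + 1) * ‖k‖) ^ m) fun j hj x => ?_).trans ?_
  · refine (norm_iteratedFDeriv_chi_le k j x).trans ?_
    refine (pow_le_pow_left₀ (by positivity) (by nlinarith) j).trans
      (pow_le_pow_right₀ (by nlinarith) hj)
  · rw [mul_assoc, ← mul_pow]
    exact mul_le_mul_of_nonneg_right (le_abs_self C) (by positivity)

theorem exists_norm_chi_le_of_fintype {ι κ : Type} [Fintype ι] [Fintype κ]
    (u : κ → Distribution ι) :
    ∃ (A : ℝ) (m : ℕ), 0 ≤ A ∧ ∀ (K : κ) (k : ι → ℤ), 1 ≤ ‖k‖ →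
      ‖(u K : Smooth ι →ₗ[ℂ] ℂ) (chi k)‖ ≤ A * ‖k‖ ^ m := by
  choose A m hA h using fun K => Distribution.exists_norm_chi_le (u K)
  refine ⟨∑ K, A K, ∑ K, m K, Finset.sum_nonneg fun K _ => hA K, fun K k hk =>
    (h K k hk).trans ?_⟩
  exact mul_le_mul (Finset.single_le_sum (fun K _ => hA K) (Finset.mem_univ K))
    (pow_le_pow_right₀ hk (Finset.single_le_sum (fun K _ => Nat.zero_le _) (Finset.mem_univ K)))
    (by positivity) (Finset.sum_nonneg fun K _ => hA K)

/-- The sign from transposing the derivative and the sign of the frequency -k cancel, giving the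
same symbol as for smooth forms. -/
theorem currentL_chi {n p : ℕ} (a : Fin n → ℝ) (u : MultiIndex n p → Distribution (Coord n))
    (k : Coord n → ℤ) (J : MultiIndex n (p + 1)) :
    (currentL a p u J : Smooth (Coord n) →ₗ[ℂ] ℂ) (chi (-k)) =
      Complex.I * wedge (fun j => (symbol a k j : ℂ))
        (fun K => (u K : Smooth (Coord n) →ₗ[ℂ] ℂ) (chi (-k))) J := by
  have hD : ∀ i K, Distribution.eval (chi (-k)) (Distribution.pderiv i (u K)) =
      Complex.I * (k i : ℂ) * (u K : Smooth (Coord n) →ₗ[ℂ] ℂ) (chi (-k)) := fun i K => by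
    rw [Distribution.eval_pderiv, pderiv_chi, Distribution.eval_apply, map_smul]
    simp
  rw [← Distribution.eval_apply, currentL,
    map_wedgeOp_add_wedgeOp a (Distribution.eval (chi (-k))) Distribution.pderiv]
  simp only [hD]
  exact sum_wedgeCoeff_symbol a k _ J

/-- A form that carries the frequencies of a Liouville sequence, with coefficients of the size of the
square root of the symbol, has no solution with polynomially bounded coefficients. -/
theorem not_globallySolvable_of_isLiouvilleForm {n p : ℕ} (hp : p < n) {a : Fin n → ℝ}
    (ha : IsLiouvilleForm a) : ¬ GloballySolvable a p := by
  classical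
  intro hsol
  obtain ⟨hr, C, η, ξ, hC, hξ, hle⟩ := ha
  let κ : ℕ → Coord n → ℤ := fun l => Sum.elim (η l) fun _ => ξ l
  have hκ2 : ∀ l, 2 ≤ ‖κ l‖ := fun l => by
    refine le_trans ?_ (norm_le_pi_norm (κ l) (Sum.inr 0))
    rw [Int.norm_eq_abs]
    exact_mod_cast hξ l
  have : Nonempty (Fin n) := ⟨⟨0, by omega⟩⟩
  choose i hi using fun k : Coord n → ℤ => Finite.exists_max fun j => |symbol a k j|
  -- Since p < n, some K avoids the index of the largest symbol component; then dt_i ∧ dt_K is a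
  -- component in which the full size δ survives.
  have hK : ∀ k, ∃ K : MultiIndex n p, i k ∉ K.1 := fun k => by
    obtain ⟨K, hK1, hK2⟩ := Finset.exists_subset_card_eq
      (s := Finset.univ.erase (i k)) (n := p) (by
        rw [Finset.card_erase_of_mem (Finset.mem_univ _), Finset.card_univ, Fintype.card_fin]
        omega)
    exact ⟨⟨K, hK2⟩, fun h => Finset.notMem_erase _ _ (hK1 h)⟩
  choose K hK using hK
  let δ : (Coord n → ℤ) → ℝ := fun k => |symbol a k (i k)|
  have hδ0 : ∀ k, 0 ≤ δ k := fun k => abs_nonneg _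
  have hsymb : ∀ k j, ‖(symbol a k j : ℂ)‖ ≤ δ k := fun k j => by
    rw [Complex.norm_real]
    exact hi k j
  -- A vanishing symbol with ξ ≠ 0 would make a rational.
  have hδpos : ∀ l, 0 < δ (κ l) := fun l => by
    refine (hδ0 _).lt_of_ne fun h0 => hr ?_
    have h1 : ∀ j, symbol a (κ l) j = 0 := fun j =>
      abs_eq_zero.1 (le_antisymm ((hi _ j).trans h0.ge) (abs_nonneg _))
    refine isRationalForm_of_isIntegralForm (ξ := ξ l) (fun h => ?_)
      (isIntegralForm_of_symbol_eq_zero h1)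
    have := hξ l
    rw [h] at this
    norm_num at this
  have hδle : ∀ l, δ (κ l) ≤ C * (‖κ l‖ ^ l)⁻¹ := fun l => by
    refine (hle l (i (κ l))).trans (mul_le_mul_of_nonneg_left ?_ hC.le)
    refine inv_anti₀ (pow_pos (by linarith [hκ2 l]) l) ?_
    exact pow_le_pow_left₀ (norm_nonneg _) (norm_le_sqrt_sum_sq (κ l)) l
  -- The exponent -1/2 leaves σ ∧ v of size δ^{1/2}, still rapidly decreasing, while v itself is too
  -- large for a current. Defining v through the range of κ makes repetitions in the sequence
  -- harmless.
  let v : (Coord n → ℤ) → MultiIndex n p → ℂ := fun k =>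
    if k ∈ Set.range κ then Pi.single (K k) ((Real.sqrt (δ k) : ℂ)⁻¹) else 0
  set D : ℝ := n * Fintype.card (MultiIndex n p)
  have hD0 : 0 ≤ D := by positivity
  let c : MultiIndex n (p + 1) → (Coord n → ℤ) → ℂ := fun J k =>
    Complex.I * wedge (fun j => (symbol a k j : ℂ)) (v k) J
  have hc0 : ∀ J k, k ∉ Set.range κ → c J k = 0 := fun J k hk => by
    have hvk : v k = 0 := if_neg hk
    simp [c, hvk, wedge]
  have hv : ∀ l, v (κ l) = Pi.single (K (κ l)) ((Real.sqrt (δ (κ l)) : ℂ)⁻¹) := fun l =>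
    if_pos ⟨l, rfl⟩
  have hcle : ∀ J l, ‖c J (κ l)‖ ≤ D * Real.sqrt (δ (κ l)) := fun J l => by
    rw [norm_mul, Complex.norm_I, one_mul, hv]
    refine (norm_wedge_le _ _ (hδ0 _) (hsymb _) (B := (Real.sqrt (δ (κ l)))⁻¹) (fun L => ?_)
      J).trans (le_of_eq ?_)
    · by_cases hL : L = K (κ l)
      · rw [hL, Pi.single_eq_same, norm_inv, Complex.norm_real,
          Real.norm_of_nonneg (Real.sqrt_nonneg _)]
      · rw [Pi.single_eq_of_ne hL, norm_zero]
        positivity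
    · rw [← div_eq_mul_inv, Real.div_sqrt]
  have hcs : ∀ J, ∀ m : ℕ, ∃ B, ∀ k, ‖k‖ ^ m * ‖c J k‖ ≤ B := fun J m => by
    have hS : ∀ l ∈ Finset.range (2 * m), 0 ≤ ‖κ l‖ ^ m * ‖c J (κ l)‖ := fun l _ => by positivity
    -- The square root halves the exponent l, so the decay beats ‖κ‖^m once l ≥ 2m; the finitely
    -- many earlier terms are added to the bound.
    refine ⟨D * Real.sqrt C + ∑ l ∈ Finset.range (2 * m), ‖κ l‖ ^ m * ‖c J (κ l)‖, fun k => ?_⟩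
    by_cases hk : k ∈ Set.range κ
    · obtain ⟨l, rfl⟩ := hk
      by_cases hl : l < 2 * m
      · exact (Finset.single_le_sum hS (Finset.mem_range.2 hl)).trans
          (le_add_of_nonneg_left (by positivity))
      · refine le_trans ?_ (le_add_of_nonneg_right (Finset.sum_nonneg hS))
        refine (mul_le_mul_of_nonneg_left (hcle J l) (by positivity)).trans ?_
        rw [mul_left_comm]
        refine mul_le_mul_of_nonneg_left ?_ hD0
        refine Real.le_sqrt_of_sq_le ?_
        rw [mul_pow, Real.sq_sqrt (hδ0 _), ← pow_mul, mul_comm m 2]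
        have hκ := hκ2 l
        have h1 : ‖κ l‖ ^ (2 * m) ≤ ‖κ l‖ ^ l := pow_le_pow_right₀ (by linarith) (by omega)
        have h2 : 0 < ‖κ l‖ ^ l := pow_pos (by linarith) l
        calc ‖κ l‖ ^ (2 * m) * δ (κ l) ≤ ‖κ l‖ ^ l * (C * (‖κ l‖ ^ l)⁻¹) :=
              mul_le_mul h1 (hδle l) (hδ0 _) h2.le
          _ = C := by field_simp
    · rw [hc0 J k hk, norm_zero, mul_zero]
      exact add_nonneg (by positivity) (Finset.sum_nonneg hS)
  let f : MultiIndex n (p + 1) → Smooth (Coord n) := fun J =>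
    Smooth.ofCoeff (c J) (summable_norm_pow_mul_of_bounded (hcs J))
  have hf : ∀ k J, coeff k (f J) = c J k := fun k J => coeff_ofCoeff _ _ k
  have hcomp : f ∈ compatible a p := by
    refine ⟨funext fun J => Smooth.eq_zero_of_coeff_eq_zero fun k => ?_, fun ζ hζ ψ _ => ?_⟩
    · rw [coeff_smoothL]
      simp only [hf, c]
      rw [wedge_const_mul]
      have h1 := congrFun (wedge_wedge (fun j => (symbol a k j : ℂ)) (v k)) J
      change wedge _ (fun J => wedge _ (v k) J) J = 0 at h1
      rw [h1, mul_zero, mul_zero]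
    · have hζ0 : ζ = 0 := by
        by_contra h
        exact hr (isRationalForm_of_isIntegralForm h hζ)
      subst hζ0
      refine ⟨0, fun J => ?_⟩
      have h1 : ∀ t, partialFourier (f J) 0 t = 0 := partialFourier_zero_eq_zero fun k hk => by
        rw [hf]
        refine hc0 J k ?_
        rintro ⟨l, rfl⟩
        have h2 := hξ l
        have h3 : ξ l = 0 := hk
        rw [h3] at h2
        norm_num at h2
      simp only [h1, zero_mul]
      have h2 : wedgeOp (fun j => Smooth.pderiv j) p (0 : MultiIndex n p → Smooth (Fin n)) J = 0 := by
        simp [wedgeOp]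
      rw [h2]
      rfl
  obtain ⟨u, hu⟩ := hsol f hcomp
  obtain ⟨A, m, hA, hAm⟩ := exists_norm_chi_le_of_fintype u
  -- Comparing the equation at κ_l with the polynomial bound on u gives T ≤ D A ‖κ_l‖^m T² with T =
  -- δ^{1/2}, after dropping a power of 2π that is at least 1. One divides by T and squares to
  -- insert the upper bound on δ.
  have key : ∀ l, 1 ≤ (D * A) ^ 2 * C * (‖κ l‖ ^ (2 * m) * (‖κ l‖ ^ l)⁻¹) := fun l => by
    have hκ := hκ2 l
    have hcard : (insert (i (κ l)) (K (κ l)).1).card = p + 1 := by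
      rw [Finset.card_insert_of_notMem (hK _), (K (κ l)).2]
    let J : MultiIndex n (p + 1) := ⟨insert (i (κ l)) (K (κ l)).1, hcard⟩
    have h1 := hu J (chi (-κ l))
    change _ = pairing (chi (-κ l)) (f J) at h1
    rw [currentL_chi, pairing_chi_neg, hf] at h1
    have h2 := congrArg norm h1
    rw [norm_mul, norm_mul, norm_mul, Complex.norm_I, one_mul, one_mul, hv,
      norm_wedge_single _ _ (hK _), norm_inv, Complex.norm_real, Complex.norm_real,
      Complex.norm_real, Real.norm_of_nonneg (Real.sqrt_nonneg _)] at h2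
    change _ = _ * (δ (κ l) * _) at h2
    rw [← div_eq_mul_inv, Real.div_sqrt, Real.norm_of_nonneg (by positivity)] at h2
    have h3 := norm_wedge_le (fun j => (symbol a (κ l) j : ℂ))
      (fun L => (u L : Smooth (Coord n) →ₗ[ℂ] ℂ) (chi (-κ l))) (hδ0 _) (hsymb _)
      (B := A * ‖κ l‖ ^ m) (fun L => by
        have := hAm L (-κ l) (by rw [norm_neg]; linarith)
        rwa [norm_neg] at this) J
    rw [h2] at h3
    have h4 : (1 : ℝ) ≤ (2 * Real.pi) ^ Fintype.card (Coord n) :=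
      one_le_pow₀ (by linarith [Real.pi_gt_three])
    set T := Real.sqrt (δ (κ l))
    have hTpos : 0 < T := Real.sqrt_pos.2 (hδpos l)
    have hTT : T ^ 2 = δ (κ l) := Real.sq_sqrt (hδ0 _)
    have h5 : T ≤ D * (δ (κ l) * (A * ‖κ l‖ ^ m)) :=
      (le_mul_of_one_le_left hTpos.le h4).trans h3
    rw [← hTT] at h5
    have h6 : 1 ≤ D * A * ‖κ l‖ ^ m * T := by
      refine le_of_mul_le_mul_right ?_ hTpos
      rw [one_mul]
      refine h5.trans (le_of_eq ?_)
      ring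
    have h7 := one_le_pow₀ h6 (n := 2)
    rw [mul_pow, hTT] at h7
    refine h7.trans ((mul_le_mul_of_nonneg_left (hδle l) (by positivity)).trans (le_of_eq ?_))
    ring
  -- For l = 2m + r the key inequality says that ‖κ_l‖^r is at most a fixed constant; since ‖κ_l‖ ≥
  -- 2, a large r contradicts this without knowing that ‖κ_l‖ tends to infinity.
  obtain ⟨r, hr⟩ := pow_unbounded_of_one_lt ((D * A) ^ 2 * C) one_lt_two
  have h1 := key (2 * m + r)
  have hκ := hκ2 (2 * m + r)
  have hpos : 0 < ‖κ (2 * m + r)‖ := by linarith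
  have h2 : ‖κ (2 * m + r)‖ ^ (2 * m) * (‖κ (2 * m + r)‖ ^ (2 * m + r))⁻¹ =
      (‖κ (2 * m + r)‖ ^ r)⁻¹ := by
    rw [pow_add]
    field_simp
  rw [h2, ← div_eq_mul_inv, one_le_div (by positivity)] at h1
  exact absurd (hr.trans_le (pow_le_pow_left₀ zero_le_two hκ r)) (not_lt.2 h1)

end TorusComplex

end

theorem mainTheorem4 (n p : ℕ) (hp : p < n) (a : Fin n → ℝ) :
    TorusComplex.GloballySolvable a p ↔
      (TorusComplex.IsRationalForm a ∨ ¬ TorusComplex.IsLiouvilleForm a) :=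
  ⟨fun h => .inr fun hL => TorusComplex.not_globallySolvable_of_isLiouvilleForm hp hL h,
    fun h => TorusComplex.globallySolvable_of_rational_or_not_liouville p h⟩
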